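/- **Theorem 2.1.** Let $n\in\mathbb N$ and let $\varphi\in\mathcal S(\mathbb R^n)$ satisfy $\int\varphi(x)\,dx=1$ and $\int x^\alpha\varphi(x)\,dx=0$ for all $\alpha\in\mathbb N^n$, $\alpha\ne0$; put $\varphi_\epsilon(x)=\epsilon^{-n}\varphi(x/\epsilon)$ for $\epsilon\in(0,1]$, and $\langle x\rangle=(1+|x|^2)^{1/2}$. Consider families $(u_\epsilon)_{\epsilon\in(0,1]}$ of smooth functions $u_\epsilon:\mathbb R^n\to\mathbb C$. Let - $\mathcal E_\tau(\mathbb R^n)$ be the algebra of the families such that for all $\alpha\in\mathbb N^n$ there is $N\in\mathbb N$ with $\sup_{\epsilon\in(0,1]}\epsilon^N\|\langle x\rangle^{-N}\partial^\alpha u_\epsilon\|_{L^\infty(\mathbb R^n)}<\infty$; - $\mathcal N_{\mathcal S}(\mathbb R^n)$ be the ideal of the families such that $\sup_{\epsilon\in(0,1]}\epsilon^{-q}\|x^\alpha\partial^\beta u_\epsilon\|_{L^\infty(\mathbb R^n)}<\infty$ for all $\alpha,\beta\in\mathbb N^n$ and $q\in\mathbb N$; - $\mathcal G_{\tau,\mathcal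 S}(\mathbb R^n)=\mathcal E_\tau(\mathbb R^n)/\mathcal N_{\mathcal S}(\mathbb R^n)$; - $\mathcal G^\infty_{\mathcal S}(\mathbb R^n)$ be the set of the elements of $\mathcal G_{\tau,\mathcal S}(\mathbb R^n)$ that have a representative $(u_\epsilon)_\epsilon$ for which there is $N\in\mathbb N$ such that $\sup_{\epsilon\in(0,1]}\epsilon^{N}\|x^\alpha\partial^\beta u_\epsilon\|_{L^\infty(\mathbb R^n)}<\infty$ for all $\alpha,\beta\in\mathbb N^n$. Then the map $\imath:\mathcal S'(\mathbb R^n)\to\mathcal G_{\tau,\mathcal S}(\mathbb R^n)$, $\imath(w)=[(w*\varphi_\epsilon)_\epsilon]$, is injective, and $\imath(f)=[(f)_\epsilon]$ for all $f\in\mathcal S(\mathbb R^n)$. With $\mathcal S'(\mathbb R^n)$ and $\mathcal S(\mathbb R^n)$ identified with their images under $\imath$ in $\mathcal G_{\tau,\mathcal S}(\mathbb R^n)$, $$\mathcal G^\infty_{\mathcal S}(\mathbb R^n)\cap\mathcal S'(\mathbb R^n)=\mathcal S(\mathbb R^n).$$ -/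

import Mathlib

open scoped SchwartzMap

namespace Colombeau

open Filter Topology
open scoped ContDiff LineDeriv

/-! ### Basic notions -/

/-- Euclidean space `ℝⁿ`. -/
abbrev Rn (n : ℕ) : Type := EuclideanSpace ℝ (Fin n)

/-- The partial derivative in the `i`-th coordinate direction. -/
noncomputable def partialDeriv {n : ℕ} (i : Fin n) (f : Rn n → ℂ) : Rn n → ℂ :=
  fun x => lineDeriv ℝ f x (EuclideanSpace.single i 1)

/-- `∂^β f` for a multi-index `β`. -/
noncomputable def multiDeriv {n : ℕ} (β : Fin n → ℕ) (f : Rn n → ℂ) : Rn n → ℂ :=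
  (List.finRange n).foldr (fun i g => (partialDeriv i)^[β i] g) f

/-- `x^α` for a multi-index `α`. -/
noncomputable def monomial {n : ℕ} (α : Fin n → ℕ) (x : Rn n) : ℝ := ∏ i, x i ^ α i

/-- `⟨x⟩ = (1 + |x|²)^{1/2}`. -/
noncomputable def bracket {n : ℕ} (x : Rn n) : ℝ := Real.sqrt (1 + ‖x‖ ^ 2)

/-- Nets `(u_ε)_ε` of complex functions on `ℝⁿ`, indexed by `ε ∈ (0, 1]`. -/
abbrev Net (n : ℕ) : Type := Set.Ioc (0 : ℝ) 1 → Rn n → ℂ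

/-- Membership in `E[ℝⁿ]`: every `u_ε` is smooth. -/
def Net.IsSmooth {n : ℕ} (u : Net n) : Prop := ∀ ε, ContDiff ℝ ∞ (u ε)

/-- Membership in `E_τ(ℝⁿ)`: for all `α` there is `N` such that
`sup_ε ε^N ‖⟨x⟩^{-N} ∂^α u_ε‖_{L^∞} < ∞`. -/
def Net.IsModerate {n : ℕ} (u : Net n) : Prop :=
  u.IsSmooth ∧ ∀ α : Fin n → ℕ, ∃ (N : ℕ) (C : ℝ), ∀ (ε : Set.Ioc (0 : ℝ) 1) (x : Rn n),
    (ε : ℝ) ^ N * ((bracket x ^ N)⁻¹ * ‖multiDeriv α (u ε) x‖) ≤ C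

/-- Membership in `N_S(ℝⁿ)`: for all `α`, `β`, `q`,
`sup_ε ε^{-q} ‖x^α ∂^β u_ε‖_{L^∞} < ∞`. -/
def Net.IsNegligible {n : ℕ} (u : Net n) : Prop :=
  u.IsSmooth ∧ ∀ (α β : Fin n → ℕ) (q : ℕ), ∃ C : ℝ, ∀ (ε : Set.Ioc (0 : ℝ) 1) (x : Rn n),
    ((ε : ℝ) ^ q)⁻¹ * ‖monomial α x * multiDeriv β (u ε) x‖ ≤ C

/-- `S`-regular nets: there is `N` such that for all `α`, `β`,
`sup_ε ε^N ‖x^α ∂^β u_ε‖_{L^∞} < ∞`. -/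
def Net.IsRegular {n : ℕ} (u : Net n) : Prop :=
  u.IsSmooth ∧ ∃ N : ℕ, ∀ α β : Fin n → ℕ, ∃ C : ℝ, ∀ (ε : Set.Ioc (0 : ℝ) 1) (x : Rn n),
    (ε : ℝ) ^ N * ‖monomial α x * multiDeriv β (u ε) x‖ ≤ C

/-- A mollifier: a Schwartz function with integral one, all of whose higher moments vanish. -/
structure IsMollifier {n : ℕ} (φ : 𝓢(Rn n, ℂ)) : Prop where
  integral_eq_one : ∫ x, φ x = 1
  moment_eq_zero : ∀ α : Fin n → ℕ, α ≠ 0 → ∫ x, (monomial α x : ℂ) * φ x = 0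

/-- `φ_ε(x) = ε^{-n} φ(x / ε)`. -/
noncomputable def dilate {n : ℕ} (φ : 𝓢(Rn n, ℂ)) (ε : Set.Ioc (0 : ℝ) 1) : 𝓢(Rn n, ℂ) :=
  (((ε : ℝ) ^ n)⁻¹ : ℂ) • SchwartzMap.compCLMOfContinuousLinearEquiv ℂ
    (ContinuousLinearEquiv.smulLeft (Units.mk0 (ε : ℝ)⁻¹ (inv_ne_zero ε.2.1.ne'))) φ

theorem dilate_apply {n : ℕ} (φ : 𝓢(Rn n, ℂ)) (ε : Set.Ioc (0 : ℝ) 1) (x : Rn n) :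
    dilate φ ε x = (((ε : ℝ) ^ n)⁻¹ : ℂ) * φ ((ε : ℝ)⁻¹ • x) := by
  simp [dilate]

/-- The Schwartz function `y ↦ ψ(x - y)`. -/
noncomputable def reflTrans {n : ℕ} (x : Rn n) (ψ : 𝓢(Rn n, ℂ)) : 𝓢(Rn n, ℂ) :=
  SchwartzMap.compSubConstCLM ℂ x
    (SchwartzMap.compCLMOfContinuousLinearEquiv ℂ (ContinuousLinearEquiv.neg ℝ) ψ)

theorem reflTrans_apply {n : ℕ} (x : Rn n) (ψ : 𝓢(Rn n, ℂ)) (y : Rn n) :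
    reflTrans x ψ y = ψ (x - y) := by
  simp [reflTrans]

/-- The net `(w ∗ φ_ε)_ε`, where `(w ∗ ψ)(x) = ⟨w, ψ(x - ·)⟩`. -/
noncomputable def convNet {n : ℕ} (φ : 𝓢(Rn n, ℂ)) (w : 𝓢'(Rn n, ℂ)) : Net n :=
  fun ε x => w (reflTrans x (dilate φ ε))

/-! ### Smoothness of the convolution of a tempered distribution with a Schwartz function -/

theorem lineDeriv_comm {n : ℕ} (a b : Rn n) (R : 𝓢(Rn n, ℂ)) :
    (∂_{a} (∂_{b} R : 𝓢(Rn n, ℂ)) : 𝓢(Rn n, ℂ)) = ∂_{b} (∂_{a} R : 𝓢(Rn n, ℂ)) := by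
  ext y
  have hs : IsSymmSndFDerivAt ℝ R y :=
    (R.smooth ⊤).contDiffAt.isSymmSndFDerivAt (by
      rw [minSmoothness_of_isRCLikeNormedField]; exact WithTop.coe_le_coe.2 le_top)
  have hd : DifferentiableAt ℝ (fderiv ℝ R) y :=
    (((R.smooth ⊤).fderiv_right (m := 1) (by norm_cast)).differentiable (by simp)) y
  have key : ∀ u v : Rn n, (∂_{u} (∂_{v} R : 𝓢(Rn n, ℂ)) : 𝓢(Rn n, ℂ)) y
      = fderiv ℝ (fderiv ℝ R) y u v := by
    intro u v
    rw [SchwartzMap.lineDerivOp_apply_eq_fderiv]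
    have : (⇑(∂_{v} R : 𝓢(Rn n, ℂ)) : Rn n → ℂ) = fun z => fderiv ℝ R z v := by
      ext z; rfl
    rw [this, fderiv_clm_apply hd (by fun_prop)]
    simp
  rw [key, key, hs a b]

theorem iteratedLineDeriv_comm {n l : ℕ} (v : Fin l → Rn n) (h : Rn n) (R : 𝓢(Rn n, ℂ)) :
    (∂^{v} (∂_{h} R : 𝓢(Rn n, ℂ)) : 𝓢(Rn n, ℂ)) = ∂_{h} (∂^{v} R : 𝓢(Rn n, ℂ)) := by
  induction l with
  | zero => simp
  | succ l ih =>
    rw [LineDeriv.iteratedLineDerivOp_succ_left, LineDeriv.iteratedLineDerivOp_succ_left, ih,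
      lineDeriv_comm]

theorem iteratedFDeriv_lineDeriv {n : ℕ} (l : ℕ) (h : Rn n) (R : 𝓢(Rn n, ℂ)) (y : Rn n)
    (v : Fin l → Rn n) :
    iteratedFDeriv ℝ l (∂_{h} R : 𝓢(Rn n, ℂ)) y v = fderiv ℝ (iteratedFDeriv ℝ l R) y h v := by
  rw [← SchwartzMap.iteratedLineDerivOp_eq_iteratedFDeriv, iteratedLineDeriv_comm,
    SchwartzMap.lineDerivOp_apply_eq_fderiv]
  have : (⇑(∂^{v} R : 𝓢(Rn n, ℂ)) : Rn n → ℂ) = fun z => iteratedFDeriv ℝ l R z v := by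
    ext z; exact SchwartzMap.iteratedLineDerivOp_eq_iteratedFDeriv
  rw [this, fderiv_continuousMultilinear_apply_const]
  · rfl
  · exact (R.smooth ⊤).differentiable_iteratedFDeriv (mod_cast ENat.natCast_lt_top l) y

theorem norm_fderiv_iteratedFDeriv_sub {E : Type*} [NormedAddCommGroup E] [NormedSpace ℝ E]
    (R : E → ℂ) (l : ℕ) (z y : E) :
    ‖fderiv ℝ (iteratedFDeriv ℝ l R) z - fderiv ℝ (iteratedFDeriv ℝ l R) y‖ ≤
      ‖iteratedFDeriv ℝ (l + 1) R z - iteratedFDeriv ℝ (l + 1) R y‖ := by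
  refine ContinuousLinearMap.opNorm_le_bound _ (norm_nonneg _) fun h => ?_
  refine ContinuousMultilinearMap.opNorm_le_bound (by positivity) fun v => ?_
  have := (iteratedFDeriv ℝ (l + 1) R z - iteratedFDeriv ℝ (l + 1) R y).le_opNorm (Fin.cons h v)
  rw [sub_apply, iteratedFDeriv_succ_apply_left,
    iteratedFDeriv_succ_apply_left, Fin.prod_univ_succ] at this
  simpa [mul_assoc] using this

theorem taylor_seminorm {n : ℕ} (R : 𝓢(Rn n, ℂ)) (k l : ℕ) :
    ∃ K : ℝ, ∀ h : Rn n, ‖h‖ ≤ 1 →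
      SchwartzMap.seminorm ℂ k l
        (SchwartzMap.compSubConstCLM ℂ h R - R + (∂_{h} R : 𝓢(Rn n, ℂ))) ≤ K * ‖h‖ ^ 2 := by
  obtain ⟨K, hK0, hK⟩ : ∃ K : ℝ, 0 ≤ K ∧
      ∀ z : Rn n, (1 + ‖z‖) ^ k * ‖iteratedFDeriv ℝ (l + 2) R z‖ ≤ K := by
    refine ⟨_, ?_, fun z => SchwartzMap.one_add_le_sup_seminorm_apply (𝕜 := ℂ)
      (m := (k, l + 2)) le_rfl le_rfl R z⟩
    positivity
  refine ⟨2 ^ k * K, fun h hh => ?_⟩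
  refine SchwartzMap.seminorm_le_bound ℂ k l _ (by positivity) fun y => ?_
  set g := iteratedFDeriv ℝ l R with hg
  have hgs : ContDiff ℝ ∞ g := (R.smooth ⊤).iteratedFDeriv_right (by norm_cast)
  have hgd : Differentiable ℝ g := hgs.differentiable (by simp)
  have hgd2 : Differentiable ℝ (iteratedFDeriv ℝ (l + 1) R) :=
    (R.smooth ⊤).differentiable_iteratedFDeriv (mod_cast ENat.natCast_lt_top (l + 1))
  have hD : iteratedFDeriv ℝ l (SchwartzMap.compSubConstCLM ℂ h R - R + (∂_{h} R : 𝓢(Rn n, ℂ))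
      : 𝓢(Rn n, ℂ)) y = g (y - h) - g y - fderiv ℝ g y ((y - h) - y) := by
    have e : (⇑(SchwartzMap.compSubConstCLM ℂ h R - R + (∂_{h} R : 𝓢(Rn n, ℂ)) : 𝓢(Rn n, ℂ))
        : Rn n → ℂ) = ((fun z => R (z - h)) - ⇑R) + ⇑(∂_{h} R : 𝓢(Rn n, ℂ)) := by
      ext z; simp
    have c1 : ContDiff ℝ ∞ (fun z => R (z - h)) := (R.smooth ⊤).comp (by fun_prop)
    rw [e, iteratedFDeriv_add_apply, iteratedFDeriv_sub_apply, iteratedFDeriv_comp_sub]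
    · ext v
      simp [iteratedFDeriv_lineDeriv, hg]
    · exact (c1.of_le (mod_cast le_top)).contDiffAt
    · exact (R.smooth l).contDiffAt
    · exact ((c1.of_le (mod_cast le_top)).sub (R.smooth l)).contDiffAt
    · exact (SchwartzMap.smooth _ l).contDiffAt
  rw [hD]
  set A := 2 ^ k * K / (1 + ‖y‖) ^ k with hA
  have hA0 : 0 ≤ A := by positivity
  have h2 : ∀ z ∈ Metric.closedBall y ‖h‖, ‖fderiv ℝ (iteratedFDeriv ℝ (l + 1) R) z‖ ≤ A := by
    intro z hz
    rw [norm_fderiv_iteratedFDeriv, hA, le_div_iff₀ (by positivity)]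
    have hz' : ‖y‖ ≤ ‖z‖ + 1 := by
      have := norm_sub_norm_le y z
      rw [Metric.mem_closedBall, dist_comm, dist_eq_norm] at hz
      linarith
    calc _ ≤ ‖iteratedFDeriv ℝ (l + 2) R z‖ * (2 * (1 + ‖z‖)) ^ k := by
            gcongr; linarith [norm_nonneg z]
      _ = 2 ^ k * ((1 + ‖z‖) ^ k * ‖iteratedFDeriv ℝ (l + 2) R z‖) := by rw [mul_pow]; ring
      _ ≤ _ := by gcongr; exact hK z
  have hcb : Convex ℝ (Metric.closedBall y ‖h‖) := convex_closedBall _ _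
  have hy : y ∈ Metric.closedBall y ‖h‖ := Metric.mem_closedBall_self (norm_nonneg _)
  have hyh : y - h ∈ Metric.closedBall y ‖h‖ := by simp
  have h1 : ∀ z ∈ Metric.closedBall y ‖h‖, ‖fderiv ℝ g z - fderiv ℝ g y‖ ≤ A * ‖h‖ := by
    intro z hz
    refine (norm_fderiv_iteratedFDeriv_sub R l z y).trans ?_
    refine (hcb.norm_image_sub_le_of_norm_fderiv_le (fun x _ => hgd2 x) h2 hy hz).trans ?_
    gcongr
    simpa [dist_eq_norm] using hz
  have h0 := hcb.norm_image_sub_le_of_norm_fderiv_le' (fun x _ => hgd x) h1 hy hyh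
  have hnh : ‖y - h - y‖ = ‖h‖ := by simp
  rw [hnh] at h0
  calc _ ≤ ‖y‖ ^ k * (A * ‖h‖ * ‖h‖) := by gcongr
    _ ≤ (1 + ‖y‖) ^ k * (A * ‖h‖ * ‖h‖) := by gcongr; linarith
    _ = _ := by rw [hA]; field_simp

theorem exists_seminorm_bound {n : ℕ} (w : 𝓢'(Rn n, ℂ)) :
    ∃ (s : Finset (ℕ × ℕ)) (C : ℝ), 0 ≤ C ∧ ∀ g : 𝓢(Rn n, ℂ),
      ‖w g‖ ≤ C * ∑ p ∈ s, SchwartzMap.seminorm ℂ p.1 p.2 g := by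
  have hc : Continuous ((normSeminorm ℂ ℂ).comp (w : 𝓢(Rn n, ℂ) →ₗ[ℂ] ℂ)) := by
    change Continuous fun g => ‖w g‖
    exact (map_continuous w).norm
  obtain ⟨s, C, -, h⟩ := Seminorm.bound_of_continuous (schwartz_withSeminorms ℂ (Rn n) ℂ) _ hc
  refine ⟨s, C, C.2, fun g => ?_⟩
  refine (h g).trans ?_
  rw [smul_apply, NNReal.smul_def, smul_eq_mul]
  gcongr
  refine (Seminorm.finset_sup_le_sum _ s g).trans ?_
  rw [← FunLike.coeAddMonoidHom_apply, map_sum, Finset.sum_apply]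
  simp [schwartzSeminormFamily]

theorem hasFDerivAt_translate {n : ℕ} (w : 𝓢'(Rn n, ℂ)) (R : 𝓢(Rn n, ℂ)) :
    HasFDerivAt (fun x => w (SchwartzMap.compSubConstCLM ℂ x R))
      (LinearMap.toContinuousLinearMap (𝕜 := ℝ)
        { toFun := fun h : Rn n => - w (∂_{h} R : 𝓢(Rn n, ℂ))
          map_add' := fun a b => by
            have e : (∂_{a + b} R : 𝓢(Rn n, ℂ)) = ∂_{a} R + (∂_{b} R : 𝓢(Rn n, ℂ)) := by
              ext y
              simp [SchwartzMap.lineDerivOp_apply_eq_fderiv]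
            rw [e, map_add]; ring
          map_smul' := fun c a => by
            have e : (∂_{c • a} R : 𝓢(Rn n, ℂ)) = (c : ℂ) • (∂_{a} R : 𝓢(Rn n, ℂ)) := by
              ext y
              simp [SchwartzMap.lineDerivOp_apply_eq_fderiv]
            rw [e, map_smul]; simp }) 0 := by
  obtain ⟨s, C, hC, hb⟩ := exists_seminorm_bound w
  choose K hK using fun p : ℕ × ℕ => taylor_seminorm R p.1 p.2
  rw [hasFDerivAt_iff_isLittleO_nhds_zero]
  have hO : (fun h : Rn n => w (SchwartzMap.compSubConstCLM ℂ h R) - w R + w (∂_{h} R : 𝓢(Rn n, ℂ)))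
      =O[𝓝 0] fun h => ‖h‖ ^ 2 := by
    refine Asymptotics.IsBigO.of_bound (C * ∑ p ∈ s, K p) ?_
    filter_upwards [Metric.closedBall_mem_nhds (0 : Rn n) one_pos] with h hh
    have hh' : ‖h‖ ≤ 1 := by simpa using hh
    have e : w (SchwartzMap.compSubConstCLM ℂ h R) - w R + w (∂_{h} R : 𝓢(Rn n, ℂ))
        = w (SchwartzMap.compSubConstCLM ℂ h R - R + (∂_{h} R : 𝓢(Rn n, ℂ))) := by
      simp
    rw [e, norm_pow, norm_norm, mul_assoc, Finset.sum_mul]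
    refine (hb _).trans ?_
    gcongr with p hp
    exact hK p h hh'
  have ho : (fun h : Rn n => ‖h‖ ^ 2) =o[𝓝 0] fun h => h := by
    simpa using Asymptotics.isLittleO_norm_pow_id (E' := Rn n) (n := 2) (by norm_num)
  refine (hO.trans_isLittleO ho).congr_left fun h => ?_
  simp [sub_eq_add_neg]

theorem reflTrans_add {n : ℕ} (x h : Rn n) (ψ : 𝓢(Rn n, ℂ)) :
    reflTrans (x + h) ψ =
      SchwartzMap.compSubConstCLM ℂ h (reflTrans x ψ) := by
  ext y; simp [reflTrans_apply]; congr 1; abel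

theorem lineDeriv_reflTrans {n : ℕ} (x h : Rn n) (ψ : 𝓢(Rn n, ℂ)) :
    (∂_{h} (reflTrans x ψ) : 𝓢(Rn n, ℂ)) = - reflTrans x (∂_{h} ψ : 𝓢(Rn n, ℂ)) := by
  ext y
  rw [SchwartzMap.lineDerivOp_apply_eq_fderiv]
  have e : (⇑(reflTrans x ψ) : Rn n → ℂ) = fun y => ψ (x - y) := funext (reflTrans_apply x ψ)
  have h1 : HasFDerivAt (fun y => ψ (x - y))
      ((fderiv ℝ ψ (x - y)).comp (-ContinuousLinearMap.id ℝ (Rn n))) y :=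
    (ψ.differentiable (x - y)).hasFDerivAt.comp y ((hasFDerivAt_id y).const_sub x)
  rw [e, h1.fderiv]
  simp [reflTrans_apply, SchwartzMap.lineDerivOp_apply_eq_fderiv]

theorem hasFDerivAt_conv {n : ℕ} (w : 𝓢'(Rn n, ℂ)) (ψ : 𝓢(Rn n, ℂ)) (x : Rn n) :
    ∃ L : Rn n →L[ℝ] ℂ, HasFDerivAt (fun x => w (reflTrans x ψ)) L x ∧
      ∀ h, L h = w (reflTrans x (∂_{h} ψ : 𝓢(Rn n, ℂ))) := by
  have h0 := hasFDerivAt_translate w (reflTrans x ψ)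
  simp_rw [← reflTrans_add] at h0
  have h1 := (hasFDerivAt_comp_add_left (f := fun z => w (reflTrans z ψ)) (x := 0) x).1 h0
  rw [add_zero] at h1
  refine ⟨_, h1, fun h => ?_⟩
  simp [lineDeriv_reflTrans]

theorem fderiv_conv {n : ℕ} (w : 𝓢'(Rn n, ℂ)) (ψ : 𝓢(Rn n, ℂ)) (x h : Rn n) :
    fderiv ℝ (fun x => w (reflTrans x ψ)) x h = w (reflTrans x (∂_{h} ψ : 𝓢(Rn n, ℂ))) := by
  obtain ⟨L, hL, h'⟩ := hasFDerivAt_conv w ψ x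
  rw [hL.fderiv, h']

theorem contDiff_conv {n : ℕ} (w : 𝓢'(Rn n, ℂ)) (ψ : 𝓢(Rn n, ℂ)) :
    ContDiff ℝ ∞ (fun x => w (reflTrans x ψ)) := by
  rw [contDiff_infty]
  intro m
  have hd : ∀ ψ : 𝓢(Rn n, ℂ), Differentiable ℝ (fun x => w (reflTrans x ψ)) := fun ψ x =>
    (hasFDerivAt_conv w ψ x).choose_spec.1.differentiableAt
  induction m generalizing ψ with
  | zero => exact contDiff_zero.2 (hd ψ).continuous
  | succ m ih =>
    push_cast
    rw [contDiff_succ_iff_fderiv_apply]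
    refine ⟨hd ψ, fun h => by simp at h, fun y => ?_⟩
    simp_rw [fderiv_conv]
    exact ih _

/-! ### Calculus of partial derivatives -/

theorem partialDeriv_eq {n : ℕ} (i : Fin n) {f : Rn n → ℂ} (hf : ContDiff ℝ ∞ f) :
    partialDeriv i f = fun x => fderiv ℝ f x (EuclideanSpace.single i 1) := by
  ext x
  exact ((hf.differentiable (by simp)) x).lineDeriv_eq_fderiv

theorem contDiff_partialDeriv {n : ℕ} (i : Fin n) {f : Rn n → ℂ} (hf : ContDiff ℝ ∞ f) :
    ContDiff ℝ ∞ (partialDeriv i f) := by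
  rw [partialDeriv_eq i hf]
  exact (hf.fderiv_right (by norm_cast)).clm_apply contDiff_const

theorem partialDeriv_comm {n : ℕ} (i j : Fin n) {f : Rn n → ℂ} (hf : ContDiff ℝ ∞ f) :
    partialDeriv i (partialDeriv j f) = partialDeriv j (partialDeriv i f) := by
  have hd : Differentiable ℝ (fderiv ℝ f) :=
    (hf.fderiv_right (m := 1) (by norm_cast)).differentiable (by simp)
  have key : ∀ i j : Fin n, partialDeriv i (partialDeriv j f) = fun x =>
      fderiv ℝ (fderiv ℝ f) x (EuclideanSpace.single i 1) (EuclideanSpace.single j 1) := by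
    intro i j
    rw [partialDeriv_eq i (contDiff_partialDeriv j hf), partialDeriv_eq j hf]
    ext x
    rw [fderiv_clm_apply (hd x) (by fun_prop)]
    simp
  rw [key, key]
  ext x
  refine (hf.contDiffAt.isSymmSndFDerivAt ?_) _ _
  rw [minSmoothness_of_isRCLikeNormedField]; exact WithTop.coe_le_coe.2 le_top

theorem partialDeriv_add {n : ℕ} (i : Fin n) {f g : Rn n → ℂ} (hf : ContDiff ℝ ∞ f)
    (hg : ContDiff ℝ ∞ g) : partialDeriv i (f + g) = partialDeriv i f + partialDeriv i g := by
  rw [partialDeriv_eq i (f := f + g) (hf.add hg), partialDeriv_eq i hf, partialDeriv_eq i hg]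
  ext x
  rw [fderiv_add (hf.differentiable (by simp) x) (hg.differentiable (by simp) x)]
  rfl

theorem partialDeriv_mul {n : ℕ} (i : Fin n) {f g : Rn n → ℂ} (hf : ContDiff ℝ ∞ f)
    (hg : ContDiff ℝ ∞ g) :
    partialDeriv i (f * g) = partialDeriv i f * g + f * partialDeriv i g := by
  rw [partialDeriv_eq i (f := f * g) (hf.mul hg), partialDeriv_eq i hf, partialDeriv_eq i hg]
  ext x
  rw [fderiv_mul (hf.differentiable (by simp) x) (hg.differentiable (by simp) x)]
  simp
  ring

/-- Iterated partial derivatives along a list of coordinate directions. -/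
noncomputable def listDeriv {n : ℕ} (l : List (Fin n)) (f : Rn n → ℂ) : Rn n → ℂ :=
  l.foldr partialDeriv f

theorem contDiff_listDeriv {n : ℕ} (l : List (Fin n)) {f : Rn n → ℂ} (hf : ContDiff ℝ ∞ f) :
    ContDiff ℝ ∞ (listDeriv l f) := by
  induction l with
  | nil => exact hf
  | cons i l ih => exact contDiff_partialDeriv i ih

theorem listDeriv_append {n : ℕ} (l m : List (Fin n)) (f : Rn n → ℂ) :
    listDeriv (l ++ m) f = listDeriv l (listDeriv m f) := by
  simp [listDeriv]

theorem listDeriv_add {n : ℕ} (l : List (Fin n)) {f g : Rn n → ℂ} (hf : ContDiff ℝ ∞ f)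
    (hg : ContDiff ℝ ∞ g) : listDeriv l (f + g) = listDeriv l f + listDeriv l g := by
  induction l with
  | nil => rfl
  | cons i l ih =>
    change partialDeriv i (listDeriv l (f + g)) = _
    rw [ih, partialDeriv_add i (contDiff_listDeriv l hf) (contDiff_listDeriv l hg)]
    rfl

theorem listDeriv_perm {n : ℕ} {l m : List (Fin n)} (h : l.Perm m) {f : Rn n → ℂ}
    (hf : ContDiff ℝ ∞ f) : listDeriv l f = listDeriv m f := by
  induction h with
  | nil => rfl
  | cons i _ ih => exact congrArg (partialDeriv i) ih
  | swap i j l => exact partialDeriv_comm _ _ (contDiff_listDeriv l hf)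
  | trans _ _ h₁ h₂ => exact h₁.trans h₂

theorem multiDeriv_eq_listDeriv {n : ℕ} (β : Fin n → ℕ) (f : Rn n → ℂ) :
    multiDeriv β f = listDeriv ((List.finRange n).flatMap fun i => List.replicate (β i) i) f := by
  unfold multiDeriv
  generalize List.finRange n = L
  induction L with
  | nil => rfl
  | cons i L ih =>
    rw [List.foldr_cons, List.flatMap_cons, listDeriv_append, ih]
    generalize listDeriv _ f = g
    induction β i with
    | zero => rfl
    | succ k ihk =>
      rw [Function.iterate_succ_apply', ihk, List.replicate_succ]
      rfl

theorem listDeriv_eq_multiDeriv {n : ℕ} (l : List (Fin n)) {f : Rn n → ℂ}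
    (hf : ContDiff ℝ ∞ f) : listDeriv l f = multiDeriv (fun i => l.count i) f := by
  rw [multiDeriv_eq_listDeriv]
  refine listDeriv_perm (List.perm_iff_count.2 fun j => ?_) hf
  rw [List.count_flatMap]
  have : (List.count j ∘ fun i => List.replicate (List.count i l) i) =
      fun i => if i = j then List.count j l else 0 := by
    ext i
    by_cases h : i = j <;> simp [List.count_replicate, h]
  rw [this, ← List.ofFn_eq_map, List.sum_ofFn]
  simp

/-- Iterated partial derivatives of a net, taken for each value of the parameter. -/
noncomputable def netDeriv {n : ℕ} (l : List (Fin n)) (u : Net n) : Net n :=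
  fun ε => listDeriv l (u ε)

theorem forall_multiDeriv_iff {n : ℕ} {u : Net n} (hu : u.IsSmooth) (Q : Net n → Prop) :
    (∀ β : Fin n → ℕ, Q fun ε => multiDeriv β (u ε)) ↔ ∀ l, Q (netDeriv l u) := by
  constructor
  · intro h l
    have := h (fun i => l.count i)
    simp_rw [← listDeriv_eq_multiDeriv l (hu _)] at this
    exact this
  · intro h β
    simp_rw [multiDeriv_eq_listDeriv]
    exact h _

theorem netDeriv_mul {n : ℕ} (Q Q₁ Q₂ : Net n → Prop)
    (hadd : ∀ u v, Q u → Q v → Q (u + v)) (hmul : ∀ u v, Q₁ u → Q₂ v → Q (u * v))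
    (l : List (Fin n)) (u v : Net n) (hu : u.IsSmooth) (hv : v.IsSmooth)
    (h₁ : ∀ l, Q₁ (netDeriv l u)) (h₂ : ∀ l, Q₂ (netDeriv l v)) : Q (netDeriv l (u * v)) := by
  induction l using List.reverseRecOn generalizing u v with
  | nil => exact hmul u v (h₁ []) (h₂ [])
  | append_singleton l i ih =>
    have hu' : Net.IsSmooth (netDeriv [i] u) := fun ε => contDiff_partialDeriv i (hu ε)
    have hv' : Net.IsSmooth (netDeriv [i] v) := fun ε => contDiff_partialDeriv i (hv ε)
    have e : netDeriv (l ++ [i]) (u * v) =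
        netDeriv l (netDeriv [i] u * v) + netDeriv l (u * netDeriv [i] v) := by
      ext1 ε
      change listDeriv (l ++ [i]) (u ε * v ε) = listDeriv l (partialDeriv i (u ε) * v ε) +
        listDeriv l (u ε * partialDeriv i (v ε))
      rw [listDeriv_append, ← listDeriv_add l (f := partialDeriv i (u ε) * v ε)
        (g := u ε * partialDeriv i (v ε)) ((hu' ε).mul (hv ε)) ((hu ε).mul (hv' ε)), ← partialDeriv_mul i (hu ε) (hv ε)]
      rfl
    rw [e]
    refine hadd _ _ (ih _ _ hu' hv (fun m => ?_) h₂) (ih _ _ hu hv' h₁ fun m => ?_)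
    · have := h₁ (m ++ [i])
      unfold netDeriv at this
      simp_rw [listDeriv_append] at this
      exact this
    · have := h₂ (m ++ [i])
      unfold netDeriv at this
      simp_rw [listDeriv_append] at this
      exact this

theorem one_le_bracket {n : ℕ} (x : Rn n) : 1 ≤ bracket x := by
  rw [bracket, Real.one_le_sqrt]; nlinarith [sq_nonneg ‖x‖]

theorem bracket_sq {n : ℕ} (x : Rn n) : bracket x ^ 2 = 1 + ∑ i, x i ^ 2 := by
  rw [bracket, Real.sq_sqrt (by positivity), EuclideanSpace.norm_sq_eq]
  simp

theorem one_add_norm_le {n : ℕ} (x : Rn n) : 1 + ‖x‖ ≤ 2 * bracket x := by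
  have h : ‖x‖ ≤ bracket x := Real.le_sqrt_of_sq_le (by linarith)
  linarith [one_le_bracket x]

def ModBound {n : ℕ} (v : Net n) : Prop :=
  ∃ (N : ℕ) (C : ℝ), ∀ (ε : Set.Ioc (0 : ℝ) 1) (x : Rn n),
    (ε : ℝ) ^ N * ((bracket x ^ N)⁻¹ * ‖v ε x‖) ≤ C

def NegBound {n : ℕ} (v : Net n) : Prop :=
  ∀ (α : Fin n → ℕ) (q : ℕ), ∃ C : ℝ, ∀ (ε : Set.Ioc (0 : ℝ) 1) (x : Rn n),
    ((ε : ℝ) ^ q)⁻¹ * ‖monomial α x * v ε x‖ ≤ C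

theorem isModerate_iff {n : ℕ} (u : Net n) :
    u.IsModerate ↔ u.IsSmooth ∧ ∀ l, ModBound (netDeriv l u) :=
  and_congr_right fun hu => forall_multiDeriv_iff hu ModBound

theorem isNegligible_iff {n : ℕ} (u : Net n) :
    u.IsNegligible ↔ u.IsSmooth ∧ ∀ l, NegBound (netDeriv l u) :=
  and_congr_right fun hu => by
    rw [← forall_multiDeriv_iff hu NegBound]
    exact ⟨fun h β α => h α β, fun h α β => h β α⟩

theorem ModBound.add {n : ℕ} {u v : Net n} (hu : ModBound u) (hv : ModBound v) :
    ModBound (u + v) := by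
  obtain ⟨N, C, h⟩ := hu
  obtain ⟨M, D, h'⟩ := hv
  refine ⟨N + M, C + D, fun ε x => ?_⟩
  have hε := ε.2.1
  have hε1 := ε.2.2
  have hb := one_le_bracket x
  have hb0 : 0 < bracket x := by linarith
  have e1 : (ε : ℝ) ^ (N + M) ≤ ε ^ N := pow_le_pow_of_le_one hε.le hε1 (by omega)
  have e2 : (ε : ℝ) ^ (N + M) ≤ ε ^ M := pow_le_pow_of_le_one hε.le hε1 (by omega)
  have b1 : (bracket x ^ (N + M))⁻¹ ≤ (bracket x ^ N)⁻¹ := by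
    exact inv_anti₀ (by positivity) (pow_le_pow_right₀ hb (by omega))
  have b2 : (bracket x ^ (N + M))⁻¹ ≤ (bracket x ^ M)⁻¹ := by
    exact inv_anti₀ (by positivity) (pow_le_pow_right₀ hb (by omega))
  calc _ ≤ (ε : ℝ) ^ (N + M) * ((bracket x ^ (N + M))⁻¹ * (‖u ε x‖ + ‖v ε x‖)) := by
        gcongr; exact norm_add_le _ _
    _ = (ε : ℝ) ^ (N + M) * ((bracket x ^ (N + M))⁻¹ * ‖u ε x‖) +
        (ε : ℝ) ^ (N + M) * ((bracket x ^ (N + M))⁻¹ * ‖v ε x‖) := by ring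
    _ ≤ (ε : ℝ) ^ N * ((bracket x ^ N)⁻¹ * ‖u ε x‖) +
        (ε : ℝ) ^ M * ((bracket x ^ M)⁻¹ * ‖v ε x‖) := by gcongr
    _ ≤ _ := add_le_add (h ε x) (h' ε x)

theorem ModBound.mul {n : ℕ} {u v : Net n} (hu : ModBound u) (hv : ModBound v) :
    ModBound (u * v) := by
  obtain ⟨N, C, h⟩ := hu
  obtain ⟨M, D, h'⟩ := hv
  refine ⟨N + M, C * D, fun ε x => ?_⟩
  have hε := ε.2.1
  have hb0 : 0 < bracket x := by linarith [one_le_bracket x]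
  calc _ = ((ε : ℝ) ^ N * ((bracket x ^ N)⁻¹ * ‖u ε x‖)) *
        ((ε : ℝ) ^ M * ((bracket x ^ M)⁻¹ * ‖v ε x‖)) := by
        simp only [Pi.mul_apply, norm_mul, pow_add, mul_inv]; ring
    _ ≤ _ := mul_le_mul (h ε x) (h' ε x) (by positivity) (le_trans (by positivity) (h ε x))

theorem NegBound.add {n : ℕ} {u v : Net n} (hu : NegBound u) (hv : NegBound v) :
    NegBound (u + v) := by
  intro α q
  obtain ⟨C, h⟩ := hu α q
  obtain ⟨D, h'⟩ := hv α q
  refine ⟨C + D, fun ε x => ?_⟩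
  have hε := ε.2.1
  calc _ ≤ ((ε : ℝ) ^ q)⁻¹ * (‖monomial α x * u ε x‖ + ‖monomial α x * v ε x‖) := by
        gcongr
        simp only [Pi.add_apply, mul_add]
        exact norm_add_le _ _
    _ ≤ _ := by rw [mul_add]; exact add_le_add (h ε x) (h' ε x)

theorem NegBound.bracket {n : ℕ} {v : Net n} (hv : NegBound v) (k : ℕ) (α : Fin n → ℕ) (q : ℕ) :
    ∃ C : ℝ, ∀ (ε : Set.Ioc (0 : ℝ) 1) (x : Rn n),
      ((ε : ℝ) ^ q)⁻¹ * (bracket x ^ (2 * k) * ‖monomial α x * v ε x‖) ≤ C := by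
  induction k generalizing α with
  | zero => simpa using hv α q
  | succ k ih =>
    choose C hC using ih
    refine ⟨C α + ∑ i, C (α + Pi.single i 2), fun ε x => ?_⟩
    have hε := ε.2.1
    have hm : ∀ i, ‖(monomial (α + Pi.single i 2) x : ℂ) * v ε x‖ =
        x i ^ 2 * ‖monomial α x * v ε x‖ := by
      intro i
      have : monomial (α + Pi.single i 2) x = x i ^ 2 * monomial α x := by
        simp only [monomial, Pi.add_apply, pow_add, Finset.prod_mul_distrib]
        rw [mul_comm]
        congr 1
        rw [Finset.prod_eq_single i]
        · simp
        · intro j _ hj; simp [hj]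
        · simp
      rw [this]
      push_cast
      rw [mul_assoc, norm_mul, norm_pow, Complex.norm_real, Real.norm_eq_abs, sq_abs]
    calc _ = ((ε : ℝ) ^ q)⁻¹ * (Colombeau.bracket x ^ (2 * k) * ‖monomial α x * v ε x‖) +
          ∑ i, ((ε : ℝ) ^ q)⁻¹ * (Colombeau.bracket x ^ (2 * k) *
            ‖(monomial (α + Pi.single i 2) x : ℂ) * v ε x‖) := by
          simp_rw [hm]
          rw [mul_add, mul_one, pow_add, bracket_sq]
          simp_rw [← Finset.mul_sum, ← Finset.sum_mul]
          ring
      _ ≤ _ := by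
          gcongr with i hi
          · exact hC _ ε x
          · exact hC _ ε x

theorem ModBound.mul_neg {n : ℕ} {u v : Net n} (hu : ModBound u) (hv : NegBound v) :
    NegBound (u * v) := by
  intro α q
  obtain ⟨N, C, h⟩ := hu
  obtain ⟨D, h'⟩ := hv.bracket N α (q + N)
  refine ⟨C * D, fun ε x => ?_⟩
  have hε := ε.2.1
  have hb := one_le_bracket x
  have hb0 : 0 < Colombeau.bracket x := by linarith
  have hpow : Colombeau.bracket x ^ N ≤ Colombeau.bracket x ^ (2 * N) :=
    pow_le_pow_right₀ hb (by omega)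
  calc _ = ((ε : ℝ) ^ N * ((Colombeau.bracket x ^ N)⁻¹ * ‖u ε x‖)) *
        (((ε : ℝ) ^ (q + N))⁻¹ * (Colombeau.bracket x ^ N * ‖monomial α x * v ε x‖)) := by
        simp only [Pi.mul_apply, norm_mul, pow_add, mul_inv]
        field_simp
    _ ≤ ((ε : ℝ) ^ N * ((Colombeau.bracket x ^ N)⁻¹ * ‖u ε x‖)) *
        (((ε : ℝ) ^ (q + N))⁻¹ * (Colombeau.bracket x ^ (2 * N) * ‖monomial α x * v ε x‖)) := by
        gcongr
    _ ≤ _ := mul_le_mul (h ε x) (h' ε x) (by positivity) (le_trans (by positivity) (h ε x))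

theorem ModBound.of_bounded {n : ℕ} {v : Net n} (C : ℝ) (h : ∀ ε x, ‖v ε x‖ ≤ C) : ModBound v :=
  ⟨0, C, fun ε x => by simpa using h ε x⟩

/-! ### The algebra of generalized functions -/

theorem listDeriv_const {n : ℕ} (l : List (Fin n)) (c : ℂ) :
    ∃ d : ℂ, listDeriv l (fun _ => c) = fun _ => d := by
  induction l with
  | nil => exact ⟨c, rfl⟩
  | cons i l ih =>
    obtain ⟨d, hd⟩ := ih
    refine ⟨0, ?_⟩
    change partialDeriv i (listDeriv l _) = _
    rw [hd]
    ext x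
    simp [partialDeriv, lineDeriv]

/-- The algebra `E_τ(ℝⁿ)` of moderate nets, with pointwise operations. -/
noncomputable def moderate (n : ℕ) : Subalgebra ℂ (Net n) where
  carrier := {u | u.IsModerate}
  mul_mem' := by
    intro u v hu hv
    rw [Set.mem_ofPred_eq, isModerate_iff] at *
    exact ⟨fun ε => (hu.1 ε).mul (hv.1 ε), fun l => netDeriv_mul ModBound ModBound ModBound
      (fun _ _ => ModBound.add) (fun _ _ => ModBound.mul) l u v hu.1 hv.1 hu.2 hv.2⟩
  add_mem' := by
    intro u v hu hv
    rw [Set.mem_ofPred_eq, isModerate_iff] at *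
    refine ⟨fun ε => (hu.1 ε).add (hv.1 ε), fun l => ?_⟩
    have e : netDeriv l (u + v) = netDeriv l u + netDeriv l v := by
      ext1 ε; exact listDeriv_add l (hu.1 ε) (hv.1 ε)
    rw [e]
    exact (hu.2 l).add (hv.2 l)
  algebraMap_mem' := by
    intro c
    rw [Set.mem_ofPred_eq, isModerate_iff]
    refine ⟨fun ε => contDiff_const, fun l => ?_⟩
    obtain ⟨d, hd⟩ := listDeriv_const (n := n) l c
    refine ModBound.of_bounded ‖d‖ fun ε x => ?_
    change ‖listDeriv l (fun _ => c) x‖ ≤ _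
    rw [hd]

/-- The negligible nets `N_S(ℝⁿ)`, as an ideal of `E_τ(ℝⁿ)`. -/
noncomputable def negligible (n : ℕ) : Ideal (moderate n) where
  carrier := {u | (u : Net n).IsNegligible}
  add_mem' := by
    intro u v hu hv
    rw [Set.mem_ofPred_eq, isNegligible_iff] at *
    refine ⟨fun ε => (hu.1 ε).add (hv.1 ε), fun l => ?_⟩
    have e : netDeriv l ((u + v : moderate n) : Net n) = netDeriv l u + netDeriv l v := by
      ext1 ε; exact listDeriv_add l (hu.1 ε) (hv.1 ε)
    rw [e]
    exact (hu.2 l).add (hv.2 l)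
  zero_mem' := by
    rw [Set.mem_ofPred_eq, isNegligible_iff]
    refine ⟨fun ε => contDiff_const, fun l α q => ⟨0, fun ε x => ?_⟩⟩
    have h0 : listDeriv l (0 : Rn n → ℂ) = 0 := by
      have := listDeriv_add l (f := (0 : Rn n → ℂ)) (g := 0) contDiff_const contDiff_const
      simpa using this
    change _ * ‖_ * listDeriv l (0 : Rn n → ℂ) x‖ ≤ _
    simp [h0]
  smul_mem' := by
    intro u v hv
    have hu := (isModerate_iff _).1 u.2
    rw [Set.mem_ofPred_eq, isNegligible_iff] at *
    exact ⟨fun ε => (hu.1 ε).mul (hv.1 ε), fun l => netDeriv_mul NegBound ModBound NegBound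
      (fun _ _ => NegBound.add) (fun _ _ => ModBound.mul_neg) l u v hu.1 hv.1 hu.2 hv.2⟩

/-- The algebra of generalized functions `G_{τ,S}(ℝⁿ) = E_τ(ℝⁿ) / N_S(ℝⁿ)`. -/
abbrev GenFun (n : ℕ) : Type := moderate n ⧸ negligible n

/-- `G^∞_S(ℝⁿ)`: the generalized functions that have an `S`-regular representative. -/
def sRegular (n : ℕ) : Set (GenFun n) :=
  {U | ∃ u : moderate n, Ideal.Quotient.mk (negligible n) u = U ∧ (u : Net n).IsRegular}

/-! ### The embeddings -/

/-- Iterated partial derivatives along a list of directions, within the Schwartz space. -/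
noncomputable def listDerivS {n : ℕ} (l : List (Fin n)) (ψ : 𝓢(Rn n, ℂ)) : 𝓢(Rn n, ℂ) :=
  l.foldr (fun i g => (∂_{(EuclideanSpace.single i 1 : Rn n)} g : 𝓢(Rn n, ℂ))) ψ

theorem listDeriv_schwartz {n : ℕ} (l : List (Fin n)) (ψ : 𝓢(Rn n, ℂ)) :
    listDeriv l ψ = listDerivS l ψ := by
  induction l with
  | nil => rfl
  | cons i l ih =>
    change partialDeriv i (listDeriv l ψ) = _
    rw [ih, partialDeriv_eq i ((listDerivS l ψ).smooth ⊤)]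
    rfl

theorem listDeriv_conv {n : ℕ} (w : 𝓢'(Rn n, ℂ)) (l : List (Fin n)) (ψ : 𝓢(Rn n, ℂ)) :
    listDeriv l (fun x => w (reflTrans x ψ)) = fun x => w (reflTrans x (listDerivS l ψ)) := by
  induction l with
  | nil => rfl
  | cons i l ih =>
    change partialDeriv i (listDeriv l _) = _
    rw [ih, partialDeriv_eq i (contDiff_conv w _)]
    ext x
    exact fderiv_conv w _ x _

theorem norm_iteratedFDeriv_listDerivS {n : ℕ} (l : List (Fin n)) (ψ : 𝓢(Rn n, ℂ)) (m : ℕ)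
    (z : Rn n) :
    ‖iteratedFDeriv ℝ m (listDerivS l ψ) z‖ ≤ ‖iteratedFDeriv ℝ (m + l.length) ψ z‖ := by
  induction l generalizing m with
  | nil => rfl
  | cons i l ih =>
    have hs : ContDiff ℝ ∞ (fderiv ℝ (listDerivS l ψ)) :=
      ((listDerivS l ψ).smooth ⊤).fderiv_right (by norm_cast)
    have := norm_iteratedFDeriv_clm_apply_const (n := m) (x := z)
      (c := (EuclideanSpace.single i 1 : Rn n)) hs.contDiffAt (WithTop.coe_le_coe.2 le_top)
    rw [norm_iteratedFDeriv_fderiv, PiLp.norm_single, norm_one, one_mul] at this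
    refine (this.trans (ih (m + 1))).trans_eq ?_
    rw [List.length_cons]
    rw [show m + 1 + l.length = m + (l.length + 1) by omega]

theorem norm_iteratedFDeriv_dilate {n : ℕ} (φ : 𝓢(Rn n, ℂ)) (ε : Set.Ioc (0 : ℝ) 1) (j : ℕ)
    (z : Rn n) : ‖iteratedFDeriv ℝ j (dilate φ ε) z‖ =
      ((ε : ℝ) ^ (n + j))⁻¹ * ‖iteratedFDeriv ℝ j φ ((ε : ℝ)⁻¹ • z)‖ := by
  have hε := ε.2.1
  have e : (⇑(dilate φ ε) : Rn n → ℂ) = (((ε : ℝ) ^ n)⁻¹ : ℝ) • fun x => φ ((ε : ℝ)⁻¹ • x) := by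
    ext x
    simp [dilate_apply]
  have hc : ContDiff ℝ j (fun x => φ ((ε : ℝ)⁻¹ • x)) := (φ.smooth j).comp (by fun_prop)
  rw [e, iteratedFDeriv_const_smul_apply hc.contDiffAt, iteratedFDeriv_comp_const_smul _ (φ.smooth j),
    norm_smul, norm_smul, norm_inv, norm_pow, norm_pow, norm_inv, Real.norm_of_nonneg hε.le,
    pow_add, mul_inv, inv_pow, mul_assoc]

theorem seminorm_reflTrans {n : ℕ} (ψ : 𝓢(Rn n, ℂ)) (k m : ℕ) (K : ℝ)
    (hK : ∀ z, (1 + ‖z‖) ^ k * ‖iteratedFDeriv ℝ m ψ z‖ ≤ K) (x : Rn n) :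
    SchwartzMap.seminorm ℂ k m (reflTrans x ψ) ≤ (1 + ‖x‖) ^ k * K := by
  have hK0 : 0 ≤ K := le_trans (by positivity) (hK 0)
  refine SchwartzMap.seminorm_le_bound ℂ k m _ (by positivity) fun y => ?_
  have e : (⇑(reflTrans x ψ) : Rn n → ℂ) =
      fun y => (fun z => ψ (LinearIsometryEquiv.neg ℝ z)) (y - x) := by
    ext y; simp [reflTrans_apply]
  have e2 : ‖iteratedFDeriv ℝ m (reflTrans x ψ) y‖ = ‖iteratedFDeriv ℝ m ψ (x - y)‖ := by
    rw [e, iteratedFDeriv_comp_sub (f := fun z => ψ (LinearIsometryEquiv.neg ℝ z))]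
    have := (LinearIsometryEquiv.neg ℝ (E := Rn n)).norm_iteratedFDeriv_comp_right (⇑ψ) (y - x) m
    rw [Function.comp_def] at this
    rw [this]
    simp
  rw [e2]
  have hy : ‖y‖ ≤ (1 + ‖x‖) * (1 + ‖x - y‖) := by
    have := norm_sub_norm_le y x
    rw [norm_sub_rev] at this
    nlinarith [norm_nonneg x, norm_nonneg (x - y)]
  calc _ ≤ ((1 + ‖x‖) * (1 + ‖x - y‖)) ^ k * ‖iteratedFDeriv ℝ m ψ (x - y)‖ := by gcongr
    _ = (1 + ‖x‖) ^ k * ((1 + ‖x - y‖) ^ k * ‖iteratedFDeriv ℝ m ψ (x - y)‖) := by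
        rw [mul_pow]; ring
    _ ≤ _ := by gcongr; exact hK _

theorem convNet_isModerate {n : ℕ} (φ : 𝓢(Rn n, ℂ)) (w : 𝓢'(Rn n, ℂ)) :
    (convNet φ w).IsModerate := by
  rw [isModerate_iff]
  refine ⟨fun ε => contDiff_conv w _, fun l => ?_⟩
  obtain ⟨s, C, hC, hb⟩ := exists_seminorm_bound w
  have hφ : ∀ p : ℕ × ℕ, ∃ K : ℝ, ∀ z : Rn n,
      (1 + ‖z‖) ^ p.1 * ‖iteratedFDeriv ℝ p.2 φ z‖ ≤ K := fun p =>
    ⟨_, fun z => SchwartzMap.one_add_le_sup_seminorm_apply (𝕜 := ℂ) (m := p) le_rfl le_rfl φ z⟩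
  choose K hK using hφ
  set d := l.length
  set N := ∑ p ∈ s, (p.1 + n + p.2 + d) with hN
  refine ⟨N, C * ∑ p ∈ s, 2 ^ p.1 * K (p.1, p.2 + d), fun ε x => ?_⟩
  have hε := ε.2.1
  have hε1 := ε.2.2
  have hbr := one_le_bracket x
  have hbr0 : 0 < bracket x := by linarith
  have e : netDeriv l (convNet φ w) ε x = w (reflTrans x (listDerivS l (dilate φ ε))) :=
    congrFun (listDeriv_conv w l (dilate φ ε)) x
  have hK0 : ∀ p, 0 ≤ K p := fun p => le_trans (by positivity) (hK p 0)
  rw [e]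
  calc _ ≤ (ε : ℝ) ^ N * ((bracket x ^ N)⁻¹ * (C * ∑ p ∈ s,
        SchwartzMap.seminorm ℂ p.1 p.2 (reflTrans x (listDerivS l (dilate φ ε))))) := by
        gcongr; exact hb _
    _ = C * ∑ p ∈ s, (ε : ℝ) ^ N * ((bracket x ^ N)⁻¹ *
        SchwartzMap.seminorm ℂ p.1 p.2 (reflTrans x (listDerivS l (dilate φ ε)))) := by
        simp_rw [← Finset.mul_sum]; ring
    _ ≤ _ := by
        refine mul_le_mul_of_nonneg_left (Finset.sum_le_sum fun p hp => ?_) hC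
        have hpN : p.1 + n + p.2 + d ≤ N :=
          Finset.single_le_sum (f := fun p : ℕ × ℕ => p.1 + n + p.2 + d)
            (fun _ _ => Nat.zero_le _) hp
        have h1 : SchwartzMap.seminorm ℂ p.1 p.2 (reflTrans x (listDerivS l (dilate φ ε))) ≤
            (1 + ‖x‖) ^ p.1 * (((ε : ℝ) ^ (n + (p.2 + d)))⁻¹ * K (p.1, p.2 + d)) := by
          refine seminorm_reflTrans _ _ _ _ (fun z => ?_) x
          have hz : ‖z‖ ≤ ‖(ε : ℝ)⁻¹ • z‖ := by
            rw [norm_smul, norm_inv, Real.norm_of_nonneg hε.le]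
            exact le_mul_of_one_le_left (norm_nonneg _) (one_le_inv₀ hε |>.2 hε1)
          calc _ ≤ (1 + ‖(ε : ℝ)⁻¹ • z‖) ^ p.1 *
                ‖iteratedFDeriv ℝ (p.2 + d) (dilate φ ε) z‖ := by
                gcongr; exact norm_iteratedFDeriv_listDerivS l _ _ _
            _ = ((ε : ℝ) ^ (n + (p.2 + d)))⁻¹ * ((1 + ‖(ε : ℝ)⁻¹ • z‖) ^ p.1 *
                ‖iteratedFDeriv ℝ (p.2 + d) φ ((ε : ℝ)⁻¹ • z)‖) := by
                rw [norm_iteratedFDeriv_dilate]; ring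
            _ ≤ _ := by gcongr; exact hK (p.1, p.2 + d) _
        have hεp : (ε : ℝ) ^ N ≤ ε ^ (n + (p.2 + d)) :=
          pow_le_pow_of_le_one hε.le hε1 (by omega)
        have hbp : bracket x ^ p.1 ≤ bracket x ^ N := pow_le_pow_right₀ hbr (by omega)
        have hx := one_add_norm_le x
        calc _ ≤ (ε : ℝ) ^ N * ((bracket x ^ N)⁻¹ *
              ((2 * bracket x) ^ p.1 * (((ε : ℝ) ^ (n + (p.2 + d)))⁻¹ * K (p.1, p.2 + d)))) := by
              have := hK0 (p.1, p.2 + d)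
              refine mul_le_mul_of_nonneg_left (mul_le_mul_of_nonneg_left (h1.trans ?_)
                (by positivity)) (by positivity)
              gcongr
          _ = (2 ^ p.1 * K (p.1, p.2 + d)) * (((ε : ℝ) ^ N / (ε : ℝ) ^ (n + (p.2 + d))) *
              (bracket x ^ p.1 / bracket x ^ N)) := by
              rw [mul_pow]; ring
          _ ≤ (2 ^ p.1 * K (p.1, p.2 + d)) * (1 * 1) := by
              have := hK0 (p.1, p.2 + d)
              gcongr
              · exact (div_le_one (by positivity)).2 hεp
              · exact (div_le_one (by positivity)).2 hbp
          _ = _ := by ring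

theorem constNet_isModerate {n : ℕ} (f : 𝓢(Rn n, ℂ)) : Net.IsModerate (fun _ => ⇑f : Net n) := by
  rw [isModerate_iff]
  refine ⟨fun ε => f.smooth ⊤, fun l => ?_⟩
  refine ModBound.of_bounded (SchwartzMap.seminorm ℂ 0 0 (listDerivS l f)) fun ε x => ?_
  change ‖listDeriv l f x‖ ≤ _
  rw [listDeriv_schwartz]
  exact SchwartzMap.norm_le_seminorm ℂ _ x

/-- The map `w ↦ [(w ∗ φ_ε)_ε]` from `S'(ℝⁿ)` to `G_{τ,S}(ℝⁿ)`. -/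
noncomputable def embedTempered {n : ℕ} (φ : 𝓢(Rn n, ℂ)) : 𝓢'(Rn n, ℂ) →ₗ[ℂ] GenFun n :=
  (Ideal.Quotient.mkₐ ℂ (negligible n)).toLinearMap ∘ₗ
    { toFun := fun w => ⟨convNet φ w, convNet_isModerate φ w⟩
      map_add' := fun _ _ => rfl
      map_smul' := fun _ _ => rfl }

/-- The map `f ↦ [(f)_ε]` from `S(ℝⁿ)` to `G_{τ,S}(ℝⁿ)`, by constant nets. -/
noncomputable def embedSchwartz (n : ℕ) : 𝓢(Rn n, ℂ) →ₗ[ℂ] GenFun n :=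
  (Ideal.Quotient.mkₐ ℂ (negligible n)).toLinearMap ∘ₗ
    { toFun := fun f => ⟨fun _ => ⇑f, constNet_isModerate f⟩
      map_add' := fun _ _ => rfl
      map_smul' := fun _ _ => rfl }

end Colombeau

/-!
If all moments of `φ` of positive order vanish, Taylor expansion shows that `φ_ε ∗ f - f` is
`O(ε ^ q)` in every Schwartz seminorm, for every `q`; in particular `[(f ∗ φ_ε)_ε] = [(f)_ε]`.
Pairing `w ∗ φ_ε` with a test function `g` amounts to applying `w` to the convolution of `g` with
the reflection of `φ_ε`, so `w ∗ φ_ε → w` weakly, and `w = 0` as soon as `(w ∗ φ_ε)_ε` is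
negligible.

Suppose finally that `u_ε = w ∗ φ_ε` is regular, with Schwartz seminorms `O(ε ^ (-N))`. Since
`φ_δ ∗ u_ε = φ_ε ∗ u_δ`,
`u_ε - u_δ = (φ_ε ∗ u_δ - u_δ) - (φ_δ ∗ u_ε - u_ε)`,
and for `ε ≤ δ ≤ 2 ε` the gain `O(ε ^ (N + 1))` of the mollification makes this `O(δ)` in every
Schwartz seminorm. Hence `u_ε` converges along `ε = 2⁻ʲ` in the Schwartz space, and its limit
represents `w`.
-/

namespace Colombeau

open Filter Topology MeasureTheory
open scoped ContDiff LineDeriv BoundedContinuousFunction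

/-! ### Taylor expansion and derivatives of Schwartz functions -/

theorem one_add_norm_le_mul {E : Type*} [SeminormedAddCommGroup E] {x y z : E}
    (h : ‖x - z‖ ≤ ‖y‖) : 1 + ‖x‖ ≤ (1 + ‖y‖) * (1 + ‖z‖) := by
  have : ‖x‖ ≤ ‖y‖ + ‖z‖ := by linarith [norm_sub_norm_le x z]
  nlinarith [mul_nonneg (norm_nonneg y) (norm_nonneg z)]

section NormedSpace

variable {E F : Type*} [NormedAddCommGroup E] [NormedSpace ℝ E] [NormedAddCommGroup F]
  [NormedSpace ℝ F]

/-- The value at the increment `h` of the Taylor polynomial of degree `q` of `f` at `x`. Its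
nonconstant terms are killed by the moment conditions on a mollifier. -/
noncomputable def taylorPolynomial (f : E → F) (q : ℕ) (x h : E) : F :=
  ∑ m ∈ Finset.range (q + 1), (m.factorial : ℝ)⁻¹ • iteratedFDeriv ℝ m f x fun _ => h

theorem norm_sub_taylorPolynomial_le [CompleteSpace F] {f : E → F} {q : ℕ}
    (hf : ContDiff ℝ (q + 1) f) {x h : E} {C : ℝ}
    (hC : ∀ t ∈ Set.Icc (0 : ℝ) 1, ‖iteratedFDeriv ℝ (q + 1) f (x + t • h)‖ ≤ C) :
    ‖f (x + h) - taylorPolynomial f q x h‖ ≤ C * ‖h‖ ^ (q + 1) := by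
  rw [map_add_eq_sum_add_integral_iteratedFDeriv fun t _ => hf.contDiffAt, taylorPolynomial,
    add_sub_cancel_left, norm_smul, norm_inv, Real.norm_natCast]
  have integrand_le : ∀ t ∈ Set.uIoc (0 : ℝ) 1,
      ‖(1 - t) ^ q • iteratedFDeriv ℝ (q + 1) f (x + t • h) fun _ => h‖ ≤
        C * ‖h‖ ^ (q + 1) := fun t ht => by
    rw [Set.uIoc_of_le zero_le_one] at ht
    rw [norm_smul, norm_pow, Real.norm_of_nonneg (sub_nonneg.2 ht.2)]
    calc (1 - t) ^ q * ‖iteratedFDeriv ℝ (q + 1) f (x + t • h) fun _ => h‖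
        ≤ 1 * ‖iteratedFDeriv ℝ (q + 1) f (x + t • h) fun _ => h‖ := by
          gcongr
          exact pow_le_one₀ (sub_nonneg.2 ht.2) (by linarith [ht.1])
      _ ≤ ‖iteratedFDeriv ℝ (q + 1) f (x + t • h)‖ * ‖h‖ ^ (q + 1) := by
          simpa using (iteratedFDeriv ℝ (q + 1) f (x + t • h)).le_opNorm fun _ => h
      _ ≤ C * ‖h‖ ^ (q + 1) := by
          gcongr
          exact hC t ⟨ht.1.le, ht.2⟩
  have integral_le := intervalIntegral.norm_integral_le_of_norm_le_const integrand_le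
  rw [sub_zero, abs_one, mul_one] at integral_le
  refine (mul_le_of_le_one_left (norm_nonneg _) (inv_le_one_of_one_le₀ ?_)).trans integral_le
  exact_mod_cast q.factorial_pos

theorem one_add_norm_pow_mul_norm_sub_taylorPolynomial_le [CompleteSpace F] {f : E → F} {q : ℕ}
    (hf : ContDiff ℝ (q + 1) f) {k : ℕ} {A : ℝ}
    (hA : ∀ z, (1 + ‖z‖) ^ k * ‖iteratedFDeriv ℝ (q + 1) f z‖ ≤ A) (x h : E) :
    (1 + ‖x‖) ^ k * ‖f (x + h) - taylorPolynomial f q x h‖ ≤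
      (1 + ‖h‖) ^ k * ‖h‖ ^ (q + 1) * A := by
  have derivative_le : ∀ t ∈ Set.Icc (0 : ℝ) 1,
      ‖iteratedFDeriv ℝ (q + 1) f (x + t • h)‖ ≤ (1 + ‖h‖) ^ k * A / (1 + ‖x‖) ^ k := by
    intro t ht
    have weight_le : 1 + ‖x‖ ≤ (1 + ‖h‖) * (1 + ‖x + t • h‖) := by
      refine one_add_norm_le_mul ?_
      rw [sub_add_cancel_left, norm_neg, norm_smul, Real.norm_of_nonneg ht.1]
      exact mul_le_of_le_one_left (norm_nonneg h) ht.2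
    rw [le_div_iff₀ (by positivity)]
    calc ‖iteratedFDeriv ℝ (q + 1) f (x + t • h)‖ * (1 + ‖x‖) ^ k
        ≤ ‖iteratedFDeriv ℝ (q + 1) f (x + t • h)‖ *
            ((1 + ‖h‖) * (1 + ‖x + t • h‖)) ^ k := by gcongr
      _ = (1 + ‖h‖) ^ k *
            ((1 + ‖x + t • h‖) ^ k * ‖iteratedFDeriv ℝ (q + 1) f (x + t • h)‖) := by
        rw [mul_pow]
        ring
      _ ≤ (1 + ‖h‖) ^ k * A := by gcongr; exact hA _
  calc (1 + ‖x‖) ^ k * ‖f (x + h) - taylorPolynomial f q x h‖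
      ≤ (1 + ‖x‖) ^ k * ((1 + ‖h‖) ^ k * A / (1 + ‖x‖) ^ k * ‖h‖ ^ (q + 1)) := by
        gcongr
        exact norm_sub_taylorPolynomial_le hf derivative_le
    _ = (1 + ‖h‖) ^ k * ‖h‖ ^ (q + 1) * A := by field_simp

theorem norm_iteratedFDeriv_lineDerivOp_le (h : E) (f : 𝓢(E, F)) (m : ℕ) (z : E) :
    ‖iteratedFDeriv ℝ m (∂_{h} f : 𝓢(E, F)) z‖ ≤ ‖h‖ * ‖iteratedFDeriv ℝ (m + 1) f z‖ := by
  have hf : ContDiff ℝ ∞ (fderiv ℝ f) := (f.smooth ⊤).fderiv_right (by norm_cast)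
  have := norm_iteratedFDeriv_clm_apply_const (n := m) (x := z) (c := h)
    hf.contDiffAt (WithTop.coe_le_coe.2 le_top)
  rwa [norm_iteratedFDeriv_fderiv] at this

theorem norm_iteratedFDeriv_iteratedLineDerivOp_le {l : ℕ} (v : Fin l → E) (f : 𝓢(E, F)) (m : ℕ)
    (z : E) : ‖iteratedFDeriv ℝ m (∂^{v} f : 𝓢(E, F)) z‖ ≤
      (∏ i, ‖v i‖) * ‖iteratedFDeriv ℝ (m + l) f z‖ := by
  induction l generalizing m with
  | zero => simp
  | succ l ih =>
    rw [LineDeriv.iteratedLineDerivOp_succ_left, Fin.prod_univ_succ, mul_assoc]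
    calc ‖iteratedFDeriv ℝ m (∂_{v 0} (∂^{Fin.tail v} f : 𝓢(E, F)) : 𝓢(E, F)) z‖
        ≤ ‖v 0‖ * ‖iteratedFDeriv ℝ (m + 1) (∂^{Fin.tail v} f : 𝓢(E, F)) z‖ :=
          norm_iteratedFDeriv_lineDerivOp_le _ _ _ _
      _ ≤ ‖v 0‖ * ((∏ i, ‖Fin.tail v i‖) * ‖iteratedFDeriv ℝ (m + 1 + l) f z‖) := by
          gcongr
          exact ih _ _
      _ = ‖v 0‖ * ((∏ i : Fin l, ‖v i.succ‖) * ‖iteratedFDeriv ℝ (m + (l + 1)) f z‖) := by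
          rw [add_assoc m 1 l, add_comm 1 l]
          rfl

theorem seminorm_lineDerivOp_le (𝕜 : Type*) [NormedField 𝕜] [NormedSpace 𝕜 F] [SMulCommClass ℝ 𝕜 F]
    (h : E) (f : 𝓢(E, F)) (k m : ℕ) :
    SchwartzMap.seminorm 𝕜 k m (∂_{h} f : 𝓢(E, F)) ≤
      ‖h‖ * SchwartzMap.seminorm 𝕜 k (m + 1) f := by
  refine SchwartzMap.seminorm_le_bound 𝕜 k m _ (by positivity) fun y => ?_
  calc ‖y‖ ^ k * ‖iteratedFDeriv ℝ m (∂_{h} f : 𝓢(E, F)) y‖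
      ≤ ‖y‖ ^ k * (‖h‖ * ‖iteratedFDeriv ℝ (m + 1) f y‖) := by
        gcongr
        exact norm_iteratedFDeriv_lineDerivOp_le h f m y
    _ = ‖h‖ * (‖y‖ ^ k * ‖iteratedFDeriv ℝ (m + 1) f y‖) := by ring
    _ ≤ ‖h‖ * SchwartzMap.seminorm 𝕜 k (m + 1) f := by
        gcongr
        exact SchwartzMap.le_seminorm 𝕜 k (m + 1) f y

theorem integrable_one_add_norm_pow_mul [MeasurableSpace E] [BorelSpace E]
    [SecondCountableTopology E] (μ : Measure E) [μ.HasTemperateGrowth] (f : 𝓢(E, F)) (k : ℕ) :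
    Integrable (fun y => (1 + ‖y‖) ^ k * ‖f y‖) μ := by
  refine (((f.integrable_pow_mul μ 0).add (f.integrable_pow_mul μ k)).const_mul
    (2 ^ (k - 1) : ℝ)).mono' (Continuous.aestronglyMeasurable (by fun_prop))
      (ae_of_all _ fun y => ?_)
  rw [Real.norm_of_nonneg (by positivity)]
  calc (1 + ‖y‖) ^ k * ‖f y‖ ≤ 2 ^ (k - 1) * (1 ^ k + ‖y‖ ^ k) * ‖f y‖ := by
        gcongr
        exact add_pow_le zero_le_one (norm_nonneg y) k
    _ = 2 ^ (k - 1) * (‖y‖ ^ 0 * ‖f y‖ + ‖y‖ ^ k * ‖f y‖) := by ring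

end NormedSpace

/-! ### Convolution of Schwartz functions -/

section Convolution

variable {n : ℕ}

/-- The convolution `g ∗ f` of two scalar Schwartz functions, as a Schwartz function. -/
noncomputable def conv (g f : 𝓢(Rn n, ℂ)) : 𝓢(Rn n, ℂ) :=
  SchwartzMap.convolution (ContinuousLinearMap.mul ℂ ℂ) g f

theorem conv_apply (g f : 𝓢(Rn n, ℂ)) (x : Rn n) : conv g f x = ∫ t, g t * f (x - t) := by
  rw [conv, SchwartzMap.convolution_apply]
  rfl

theorem conv_comm (g f : 𝓢(Rn n, ℂ)) : conv g f = conv f g := by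
  rw [conv, ← SchwartzMap.convolution_flip, ContinuousLinearMap.flip_mul, conv]

theorem toTemperedDistributionCLM_reflTrans (g f : 𝓢(Rn n, ℂ)) (x : Rn n) :
    SchwartzMap.toTemperedDistributionCLM (Rn n) ℂ volume g (reflTrans x f) = conv g f x := by
  simp [conv_apply, reflTrans_apply, mul_comm]

theorem lineDerivOp_conv (g f : 𝓢(Rn n, ℂ)) (h : Rn n) :
    (∂_{h} (conv g f) : 𝓢(Rn n, ℂ)) = conv g (∂_{h} f : 𝓢(Rn n, ℂ)) := by
  ext x
  rw [SchwartzMap.lineDerivOp_apply_eq_fderiv, ← toTemperedDistributionCLM_reflTrans,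
    ← fderiv_conv]
  simp_rw [toTemperedDistributionCLM_reflTrans]

theorem iteratedLineDerivOp_conv {l : ℕ} (g f : 𝓢(Rn n, ℂ)) (v : Fin l → Rn n) :
    (∂^{v} (conv g f) : 𝓢(Rn n, ℂ)) = conv g (∂^{v} f : 𝓢(Rn n, ℂ)) := by
  induction l with
  | zero => simp
  | succ l ih =>
    rw [LineDeriv.iteratedLineDerivOp_succ_left, LineDeriv.iteratedLineDerivOp_succ_left, ih,
      lineDerivOp_conv]

theorem conv_dilate_apply (φ f : 𝓢(Rn n, ℂ)) (ε : Set.Ioc (0 : ℝ) 1) (x : Rn n) :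
    conv (dilate φ ε) f x = ∫ y, φ y * f (x - (ε : ℝ) • y) := by
  have hε : (0 : ℝ) < ε := ε.2.1
  have integrand_eq : ∀ t, dilate φ ε t * f (x - t) = ((((ε : ℝ) ^ n)⁻¹ : ℝ) : ℂ) *
      (φ ((ε : ℝ)⁻¹ • t) * f (x - (ε : ℝ) • (ε : ℝ)⁻¹ • t)) := fun t => by
    rw [dilate_apply, smul_inv_smul₀ hε.ne', mul_assoc]
    push_cast
    rfl
  simp_rw [conv_apply, integrand_eq]
  rw [integral_const_mul, Measure.integral_comp_inv_smul_of_nonneg volume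
    (fun y => φ y * f (x - (ε : ℝ) • y)) hε.le, finrank_euclideanSpace_fin, Complex.real_smul,
    ← mul_assoc, ← Complex.ofReal_mul, inv_mul_cancel₀ (by positivity), Complex.ofReal_one, one_mul]

end Convolution

/-! ### Mollification of Schwartz functions -/

section Mollification

variable {n m : ℕ}

theorem norm_monomial_le (α : Fin n → ℕ) (x : Rn n) : ‖(monomial α x : ℂ)‖ ≤ ‖x‖ ^ ∑ i, α i := by
  rw [Complex.norm_real, monomial, norm_prod, ← Finset.prod_pow_eq_pow_sum]
  gcongr with i
  rw [norm_pow]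
  gcongr
  exact PiLp.norm_apply_le x i

theorem continuous_monomial (α : Fin n → ℕ) : Continuous (monomial α) := by
  unfold monomial
  fun_prop

theorem integrable_monomial_mul (φ : 𝓢(Rn n, ℂ)) (α : Fin n → ℕ) :
    Integrable fun x => (monomial α x : ℂ) * φ x := by
  refine (φ.integrable_pow_mul volume (∑ i, α i)).mono'
    ((Complex.continuous_ofReal.comp (continuous_monomial α)).mul
      φ.continuous).aestronglyMeasurable (ae_of_all _ fun x => ?_)
  rw [norm_mul]
  gcongr
  exact norm_monomial_le α x

/-- The multi-index counting the occurrences of each coordinate direction in `s`, so that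
`x^(indexCount s) = ∏ i, x (s i)`. -/
def indexCount (s : Fin m → Fin n) (j : Fin n) : ℕ := (Finset.univ.filter fun i => s i = j).card

theorem indexCount_ne_zero [NeZero m] (s : Fin m → Fin n) : indexCount s ≠ 0 := fun h =>
  (Finset.card_pos.2 ⟨0, by simp⟩).ne' (congrFun h (s 0))

theorem monomial_indexCount (s : Fin m → Fin n) (y : Rn n) :
    monomial (indexCount s) y = ∏ i, y (s i) := by
  rw [monomial, ← Finset.prod_fiberwise_of_maps_to (t := Finset.univ) (g := s)
    (fun _ _ => Finset.mem_univ _)]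
  refine Finset.prod_congr rfl fun j _ => ?_
  rw [indexCount, ← Finset.prod_const]
  exact Finset.prod_congr rfl fun i hi => by rw [(Finset.mem_filter.1 hi).2]

theorem multilinear_diag_eq_sum_monomial {F : Type*} [NormedAddCommGroup F] [NormedSpace ℝ F]
    (M : ContinuousMultilinearMap ℝ (fun _ : Fin m => Rn n) F) (y : Rn n) :
    M (fun _ => y) = ∑ s : Fin m → Fin n,
      monomial (indexCount s) y • M fun i => EuclideanSpace.single (s i) 1 := by
  have hy : y = ∑ j, y j • EuclideanSpace.single j 1 := by
    simpa using ((EuclideanSpace.basisFun (Fin n) ℝ).sum_repr y).symm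
  conv_lhs => rw [hy, ContinuousMultilinearMap.map_sum]
  simp_rw [ContinuousMultilinearMap.map_smul_univ, monomial_indexCount]

theorem mul_multilinear_diag_eq_sum (φ : 𝓢(Rn n, ℂ))
    (M : ContinuousMultilinearMap ℝ (fun _ : Fin m => Rn n) ℂ) (y : Rn n) :
    φ y * M (fun _ => y) = ∑ s : Fin m → Fin n,
      (monomial (indexCount s) y * φ y) * M fun i => EuclideanSpace.single (s i) 1 := by
  rw [multilinear_diag_eq_sum_monomial, Finset.mul_sum]
  exact Finset.sum_congr rfl fun s _ => by rw [Complex.real_smul]; ring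

theorem integrable_mul_multilinear_diag (φ : 𝓢(Rn n, ℂ))
    (M : ContinuousMultilinearMap ℝ (fun _ : Fin m => Rn n) ℂ) :
    Integrable fun y => φ y * M fun _ => y := by
  simp_rw [mul_multilinear_diag_eq_sum]
  exact integrable_finsetSum _ fun s _ => (integrable_monomial_mul φ _).mul_const _

theorem IsMollifier.integral_mul_multilinear_diag [NeZero m] {φ : 𝓢(Rn n, ℂ)} (hφ : IsMollifier φ)
    (M : ContinuousMultilinearMap ℝ (fun _ : Fin m => Rn n) ℂ) :
    ∫ y, φ y * M (fun _ => y) = 0 := by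
  simp_rw [mul_multilinear_diag_eq_sum]
  rw [integral_finsetSum _ fun s _ => (integrable_monomial_mul φ _).mul_const _]
  refine Finset.sum_eq_zero fun s _ => ?_
  rw [integral_mul_const, hφ.moment_eq_zero _ (indexCount_ne_zero s), zero_mul]

theorem mul_taylorPolynomial_smul_eq_sum (φ : 𝓢(Rn n, ℂ)) (f : Rn n → ℂ) (q : ℕ) (x : Rn n) (c : ℝ)
    (y : Rn n) : φ y * taylorPolynomial f q x (c • y) = ∑ m ∈ Finset.range (q + 1),
      (((m.factorial : ℝ)⁻¹ * c ^ m : ℝ) : ℂ) * (φ y * iteratedFDeriv ℝ m f x fun _ => y) := by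
  rw [taylorPolynomial, Finset.mul_sum]
  refine Finset.sum_congr rfl fun m _ => ?_
  have homogeneous : (iteratedFDeriv ℝ m f x fun _ => c • y) =
      c ^ m • iteratedFDeriv ℝ m f x fun _ => y := by
    simpa using (iteratedFDeriv ℝ m f x).map_smul_univ (fun _ => c) fun _ => y
  rw [homogeneous, Complex.real_smul, Complex.real_smul]
  push_cast
  ring

theorem integrable_mul_taylorPolynomial_smul (φ : 𝓢(Rn n, ℂ)) (f : Rn n → ℂ) (q : ℕ) (x : Rn n)
    (c : ℝ) : Integrable fun y => φ y * taylorPolynomial f q x (c • y) := by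
  simp_rw [mul_taylorPolynomial_smul_eq_sum]
  exact integrable_finsetSum _ fun m _ => (integrable_mul_multilinear_diag φ _).const_mul _

theorem IsMollifier.integral_mul_taylorPolynomial_smul {φ : 𝓢(Rn n, ℂ)} (hφ : IsMollifier φ)
    (f : Rn n → ℂ) (q : ℕ) (x : Rn n) (c : ℝ) :
    ∫ y, φ y * taylorPolynomial f q x (c • y) = f x := by
  simp_rw [mul_taylorPolynomial_smul_eq_sum]
  rw [integral_finsetSum _ fun m _ => (integrable_mul_multilinear_diag φ _).const_mul _,
    Finset.sum_eq_single 0]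
  · simp [integral_mul_const, hφ.integral_eq_one]
  · intro m _ hm
    have : NeZero m := ⟨hm⟩
    rw [integral_const_mul, hφ.integral_mul_multilinear_diag, mul_zero]
  · simp

theorem IsMollifier.conv_dilate_sub_eq_integral {φ : 𝓢(Rn n, ℂ)} (hφ : IsMollifier φ)
    (f : 𝓢(Rn n, ℂ)) (q : ℕ) (ε : Set.Ioc (0 : ℝ) 1) (x : Rn n) :
    conv (dilate φ ε) f x - f x =
      ∫ y, φ y * (f (x + -(ε : ℝ) • y) - taylorPolynomial f q x (-(ε : ℝ) • y)) := by
  have integrable_shift : Integrable fun y => φ y * f (x + -(ε : ℝ) • y) :=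
    φ.integrable.mul_bdd (c := SchwartzMap.seminorm ℂ 0 0 f)
      (f.continuous.comp (by fun_prop)).aestronglyMeasurable
      (ae_of_all _ fun y => SchwartzMap.norm_le_seminorm ℂ f _)
  simp_rw [mul_sub]
  rw [integral_sub integrable_shift (integrable_mul_taylorPolynomial_smul φ f q x _),
    hφ.integral_mul_taylorPolynomial_smul, conv_dilate_apply]
  simp_rw [neg_smul, ← sub_eq_add_neg]

theorem IsMollifier.norm_conv_dilate_sub_le {φ : 𝓢(Rn n, ℂ)} (hφ : IsMollifier φ) {k q : ℕ}
    (f : 𝓢(Rn n, ℂ)) (ε : Set.Ioc (0 : ℝ) 1) {A : ℝ}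
    (hA : ∀ z, (1 + ‖z‖) ^ k * ‖iteratedFDeriv ℝ (q + 1) f z‖ ≤ A) (x : Rn n) :
    (1 + ‖x‖) ^ k * ‖conv (dilate φ ε) f x - f x‖ ≤
      (∫ y, (1 + ‖y‖) ^ (k + (q + 1)) * ‖φ y‖) * ((ε : ℝ) ^ (q + 1) * A) := by
  have hε : (0 : ℝ) ≤ ε := ε.2.1.le
  have hA₀ : 0 ≤ A := le_trans (by positivity) (hA 0)
  have norm_step (y : Rn n) : ‖-(ε : ℝ) • y‖ = ε * ‖y‖ := by
    rw [norm_smul, norm_neg, Real.norm_of_nonneg hε]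
  have integrand_le (y : Rn n) : (1 + ‖x‖) ^ k *
      ‖φ y * (f (x + -(ε : ℝ) • y) - taylorPolynomial f q x (-(ε : ℝ) • y))‖ ≤
        ((1 + ‖y‖) ^ (k + (q + 1)) * ‖φ y‖) * ((ε : ℝ) ^ (q + 1) * A) := by
    rw [norm_mul, mul_left_comm]
    calc ‖φ y‖ * ((1 + ‖x‖) ^ k *
            ‖f (x + -(ε : ℝ) • y) - taylorPolynomial f q x (-(ε : ℝ) • y)‖)
        ≤ ‖φ y‖ * ((1 + ε * ‖y‖) ^ k * (ε * ‖y‖) ^ (q + 1) * A) := by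
          refine mul_le_mul_of_nonneg_left ?_ (norm_nonneg _)
          rw [← norm_step y]
          exact one_add_norm_pow_mul_norm_sub_taylorPolynomial_le
            (mod_cast f.smooth (q + 1)) hA x _
      _ ≤ ‖φ y‖ * ((1 + 1 * ‖y‖) ^ k * (ε * (1 + ‖y‖)) ^ (q + 1) * A) := by
          gcongr
          · exact ε.2.2
          · linarith
      _ = ((1 + ‖y‖) ^ (k + (q + 1)) * ‖φ y‖) * ((ε : ℝ) ^ (q + 1) * A) := by
          rw [mul_pow]
          ring
  rw [hφ.conv_dilate_sub_eq_integral f q, ← integral_mul_const]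
  refine (mul_le_mul_of_nonneg_left (norm_integral_le_integral_norm _) (by positivity)).trans ?_
  rw [← integral_const_mul]
  exact integral_mono_of_nonneg (ae_of_all _ fun y => by positivity)
    ((integrable_one_add_norm_pow_mul volume φ _).mul_const _) (ae_of_all _ integrand_le)

theorem IsMollifier.norm_iteratedLineDerivOp_conv_dilate_sub_le {φ : 𝓢(Rn n, ℂ)}
    (hφ : IsMollifier φ) (k q : ℕ) (f : 𝓢(Rn n, ℂ)) (ε : Set.Ioc (0 : ℝ) 1) (v : Fin m → Rn n)
    (x : Rn n) : (1 + ‖x‖) ^ k * ‖(∂^{v} (conv (dilate φ ε) f - f) : 𝓢(Rn n, ℂ)) x‖ ≤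
      (∫ y, (1 + ‖y‖) ^ (k + (q + 1)) * ‖φ y‖) * ((ε : ℝ) ^ (q + 1) * ((∏ i, ‖v i‖) * (2 ^ k *
        ((Finset.Iic (k, q + 1 + m)).sup (schwartzSeminormFamily ℂ (Rn n) ℂ)) f))) := by
  have commute : (∂^{v} (conv (dilate φ ε) f - f) : 𝓢(Rn n, ℂ)) =
      conv (dilate φ ε) (∂^{v} f : 𝓢(Rn n, ℂ)) - (∂^{v} f : 𝓢(Rn n, ℂ)) := by
    rw [← iteratedLineDerivOp_conv, sub_eq_add_neg, LineDeriv.iteratedLineDerivOp_add,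
      LineDeriv.iteratedLineDerivOp_neg, sub_eq_add_neg]
  rw [commute]
  refine hφ.norm_conv_dilate_sub_le (∂^{v} f : 𝓢(Rn n, ℂ)) ε (fun z => ?_) x
  calc (1 + ‖z‖) ^ k * ‖iteratedFDeriv ℝ (q + 1) (∂^{v} f : 𝓢(Rn n, ℂ)) z‖
      ≤ (1 + ‖z‖) ^ k * ((∏ i, ‖v i‖) * ‖iteratedFDeriv ℝ (q + 1 + m) f z‖) := by
        gcongr
        exact norm_iteratedFDeriv_iteratedLineDerivOp_le v f _ z
    _ = (∏ i, ‖v i‖) * ((1 + ‖z‖) ^ k * ‖iteratedFDeriv ℝ (q + 1 + m) f z‖) := by ring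
    _ ≤ (∏ i, ‖v i‖) * (2 ^ k *
          ((Finset.Iic (k, q + 1 + m)).sup (schwartzSeminormFamily ℂ (Rn n) ℂ)) f) := by
        refine mul_le_mul_of_nonneg_left ?_ (by positivity)
        exact SchwartzMap.one_add_le_sup_seminorm_apply (𝕜 := ℂ)
          (m := (k, q + 1 + m)) le_rfl le_rfl f z

theorem IsMollifier.exists_seminorm_conv_dilate_sub_le {φ : 𝓢(Rn n, ℂ)} (hφ : IsMollifier φ)
    (k m q : ℕ) : ∃ C : ℝ, 0 ≤ C ∧ ∀ (f : 𝓢(Rn n, ℂ)) (ε : Set.Ioc (0 : ℝ) 1),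
      SchwartzMap.seminorm ℂ k m (conv (dilate φ ε) f - f) ≤ C * (ε : ℝ) ^ (q + 1) *
        ((Finset.Iic (k, q + 1 + m)).sup (schwartzSeminormFamily ℂ (Rn n) ℂ)) f := by
  refine ⟨(∫ y, (1 + ‖y‖) ^ (k + (q + 1)) * ‖φ y‖) * 2 ^ k, by positivity, fun f ε => ?_⟩
  have hε : (0 : ℝ) ≤ ε := ε.2.1.le
  refine SchwartzMap.seminorm_le_bound ℂ k m _ (by positivity) fun x => ?_
  rw [← norm_norm x, ← norm_pow, ← norm_smul]
  refine ContinuousMultilinearMap.opNorm_le_bound (by positivity) fun v => ?_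
  rw [smul_apply, ← SchwartzMap.iteratedLineDerivOp_eq_iteratedFDeriv, norm_smul,
    norm_pow, norm_norm]
  calc ‖x‖ ^ k * ‖(∂^{v} (conv (dilate φ ε) f - f) : 𝓢(Rn n, ℂ)) x‖
      ≤ (1 + ‖x‖) ^ k * ‖(∂^{v} (conv (dilate φ ε) f - f) : 𝓢(Rn n, ℂ)) x‖ := by
        gcongr
        linarith
    _ ≤ _ := hφ.norm_iteratedLineDerivOp_conv_dilate_sub_le k q f ε v x
    _ = _ := by ring

end Mollification

/-! ### Tempered distributions and integrals -/

theorem exists_continuousLinearMap_comp_eq {𝕜 V X : Type*} [RCLike 𝕜] [AddCommGroup V] [Module 𝕜 V]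
    [NormedAddCommGroup X] [NormedSpace 𝕜 X] (J : V →ₗ[𝕜] X) (w : V →ₗ[𝕜] 𝕜) {C : ℝ}
    (h : ∀ v, ‖w v‖ ≤ C * ‖J v‖) : ∃ L : X →L[𝕜] 𝕜, ∀ v, L (J v) = w v := by
  have ker_le : LinearMap.ker J ≤ LinearMap.ker w := fun v hv => by
    have := h v
    rw [LinearMap.mem_ker.1 hv, norm_zero, mul_zero] at this
    exact norm_le_zero_iff.1 this
  set w' : LinearMap.range J →ₗ[𝕜] 𝕜 :=
    (LinearMap.ker J).liftQ w ker_le ∘ₗ J.quotKerEquivRange.symm.toLinearMap with w'_def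
  have w'_apply (v : V) : w' ⟨J v, LinearMap.mem_range_self J v⟩ = w v := by
    have : J.quotKerEquivRange.symm ⟨J v, LinearMap.mem_range_self J v⟩ =
        (LinearMap.ker J).mkQ v := by
      rw [LinearEquiv.symm_apply_eq]
      rfl
    rw [w'_def, LinearMap.comp_apply, LinearEquiv.coe_coe, this, Submodule.mkQ_apply,
      Submodule.liftQ_apply]
  obtain ⟨L, hL, -⟩ := exists_extension_norm_eq (LinearMap.range J) (w'.mkContinuous C (by
    rintro ⟨_, v, rfl⟩
    rw [w'_apply]
    exact h v))
  exact ⟨L, fun v => (hL ⟨J v, LinearMap.mem_range_self J v⟩).trans (w'_apply v)⟩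

section WeightedDeriv

/-- Bounded continuous fields of `m`-linear maps from `E` to `F`. The metric on the values is
spelled out: the one found by default differs from the metric of the norm by more than reducible
unfolding, which hides the Banach space structure from integrals. -/
abbrev BoundedMultilinearField (E F : Type*) [NormedAddCommGroup E] [NormedSpace ℝ E]
    [NormedAddCommGroup F] [NormedSpace ℝ F] (m : ℕ) : Type _ :=
  @BoundedContinuousFunction E (E [×m]→L[ℝ] F) _
    NormedAddCommGroup.toSeminormedAddCommGroup.toPseudoMetricSpace

variable {E F : Type*} [NormedAddCommGroup E] [NormedSpace ℝ E] [NormedAddCommGroup F]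
  [NormedSpace ℝ F] (𝕜 : Type*) [RCLike 𝕜] [NormedSpace 𝕜 F] [SMulCommClass ℝ 𝕜 F]

/-- The weighted derivative `y ↦ ‖y‖ ^ k D^m f(y)` of a Schwartz function, as an element of a
Banach space whose norm is the Schwartz seminorm of index `(k, m)`. -/
noncomputable def weightedDeriv (k m : ℕ) : 𝓢(E, F) →L[𝕜] BoundedMultilinearField E F m :=
  SchwartzMap.mkCLMtoNormedSpace (D := E) (E := F) (σ := RingHom.id 𝕜)
    (fun f => BoundedContinuousFunction.ofNormedAddCommGroup
      (fun y => ‖y‖ ^ k • iteratedFDeriv ℝ m f y)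
      ((continuous_norm.pow k).smul ((f.smooth m).continuous_iteratedFDeriv le_rfl))
      (SchwartzMap.seminorm 𝕜 k m f) fun y => by
        rw [norm_smul, norm_pow, norm_norm]
        exact SchwartzMap.le_seminorm 𝕜 k m f y)
    (fun f g => by
      ext1 y
      change ‖y‖ ^ k • iteratedFDeriv ℝ m (⇑f + ⇑g) y =
        ‖y‖ ^ k • iteratedFDeriv ℝ m f y + ‖y‖ ^ k • iteratedFDeriv ℝ m g y
      rw [iteratedFDeriv_add_apply (f.smooth m).contDiffAt (g.smooth m).contDiffAt, smul_add])
    (fun c f => by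
      ext1 y
      change ‖y‖ ^ k • iteratedFDeriv ℝ m (c • ⇑f) y = c • ‖y‖ ^ k • iteratedFDeriv ℝ m f y
      rw [iteratedFDeriv_const_smul_apply (f.smooth m).contDiffAt, smul_comm])
    ⟨{(k, m)}, 1, zero_le_one, fun f => by
      rw [one_mul, Finset.sup_singleton]
      exact BoundedContinuousFunction.norm_ofNormedAddCommGroup_le _ (apply_nonneg _ _) _⟩

theorem weightedDeriv_apply (k m : ℕ) (f : 𝓢(E, F)) (y : E) :
    weightedDeriv 𝕜 k m f y = ‖y‖ ^ k • iteratedFDeriv ℝ m f y := rfl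

theorem norm_weightedDeriv (k m : ℕ) (f : 𝓢(E, F)) :
    ‖weightedDeriv 𝕜 k m f‖ = SchwartzMap.seminorm 𝕜 k m f := by
  refine le_antisymm ((BoundedContinuousFunction.norm_le (apply_nonneg _ _)).2 fun y => ?_)
    (SchwartzMap.seminorm_le_bound 𝕜 k m f (norm_nonneg _) fun y => ?_)
  · rw [weightedDeriv_apply, norm_smul, norm_pow, norm_norm]
    exact SchwartzMap.le_seminorm 𝕜 k m f y
  · rw [← norm_norm y, ← norm_pow, ← norm_smul]
    exact (weightedDeriv 𝕜 k m f).norm_coe_le_norm y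

end WeightedDeriv

section TemperedDistribution

variable {n : ℕ}

/- The Schwartz space is not normed, so Bochner integrals cannot be moved through `w` directly;
they can through the functionals `L p`, which live on Banach spaces. -/
theorem exists_eq_sum_weightedDeriv (w : 𝓢'(Rn n, ℂ)) :
    ∃ (s : Finset (ℕ × ℕ)) (L : (p : s) → BoundedMultilinearField (Rn n) ℂ p.1.2 →L[ℂ] ℂ),
      ∀ f : 𝓢(Rn n, ℂ), w f = ∑ p : s, L p (weightedDeriv ℂ p.1.1 p.1.2 f) := by
  obtain ⟨s, C, hC, norm_le⟩ := exists_seminorm_bound w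
  let J : 𝓢(Rn n, ℂ) →L[ℂ] ((p : s) → BoundedMultilinearField (Rn n) ℂ p.1.2) :=
    ContinuousLinearMap.pi fun p => weightedDeriv ℂ p.1.1 p.1.2
  have norm_le_J (f : 𝓢(Rn n, ℂ)) : ‖w f‖ ≤ C * s.card * ‖J f‖ := by
    refine (norm_le f).trans ?_
    rw [mul_assoc, ← nsmul_eq_mul]
    gcongr
    refine Finset.sum_le_card_nsmul _ _ _ fun p hp => ?_
    rw [← norm_weightedDeriv]
    exact norm_le_pi_norm (J f) ⟨p, hp⟩
  obtain ⟨L, hL⟩ := exists_continuousLinearMap_comp_eq J.toLinearMap w.toLinearMap norm_le_J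
  refine ⟨s, fun p => L ∘L ContinuousLinearMap.single ℂ
    (fun p : s => BoundedMultilinearField (Rn n) ℂ p.1.2) p, fun f => ?_⟩
  exact (hL f).symm.trans
    (ContinuousLinearMap.sum_comp_single ℂ (fun p : s => BoundedMultilinearField (Rn n) ℂ p.1.2)
      L (J f)).symm

theorem iteratedLineDerivOp_reflTrans {l : ℕ} (x : Rn n) (v : Fin l → Rn n) (ψ : 𝓢(Rn n, ℂ)) :
    (∂^{v} (reflTrans x ψ) : 𝓢(Rn n, ℂ)) =
      (-1 : ℝ) ^ l • reflTrans x (∂^{v} ψ : 𝓢(Rn n, ℂ)) := by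
  induction l with
  | zero => simp
  | succ l ih =>
    rw [LineDeriv.iteratedLineDerivOp_succ_left, LineDeriv.iteratedLineDerivOp_succ_left, ih,
      LineDeriv.lineDerivOp_smul, lineDeriv_reflTrans, pow_succ, mul_neg_one, neg_smul, smul_neg]

theorem continuous_reflTrans (ψ : 𝓢(Rn n, ℂ)) : Continuous fun x => reflTrans x ψ := by
  refine continuous_iff_continuousAt.2 fun x =>
    ((schwartz_withSeminorms ℂ (Rn n) ℂ).tendsto_nhds _ _).2 fun p r hr => ?_
  obtain ⟨K, taylor_le⟩ := taylor_seminorm (reflTrans x ψ) p.1 p.2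
  set S := SchwartzMap.seminorm ℂ p.1 (p.2 + 1) (reflTrans x ψ)
  have bound_lt : ∀ᶠ z in 𝓝 x, K * ‖z - x‖ ^ 2 + ‖z - x‖ * S < r := by
    have : ContinuousAt (fun z : Rn n => K * ‖z - x‖ ^ 2 + ‖z - x‖ * S) x := by fun_prop
    exact this.eventually_lt_const (by simpa using hr)
  filter_upwards [bound_lt, Metric.closedBall_mem_nhds x one_pos] with z hz hzx
  refine lt_of_le_of_lt ?_ hz
  obtain ⟨h, rfl⟩ : ∃ h, z = x + h := ⟨z - x, (add_sub_cancel x z).symm⟩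
  rw [mem_closedBall_iff_norm, add_sub_cancel_left] at hzx
  rw [add_sub_cancel_left, reflTrans_add, ← add_sub_cancel_right
    (SchwartzMap.compSubConstCLM ℂ h (reflTrans x ψ) - reflTrans x ψ)
    (∂_{h} (reflTrans x ψ) : 𝓢(Rn n, ℂ))]
  exact (map_sub_le_add _ _ _).trans
    (add_le_add (taylor_le h hzx) (seminorm_lineDerivOp_le ℂ h _ p.1 p.2))

theorem integrable_smul_weightedDeriv_reflTrans (g ψ : 𝓢(Rn n, ℂ)) (k m : ℕ) :
    Integrable fun x => g x • weightedDeriv ℂ k m (reflTrans x ψ) := by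
  obtain ⟨K, seminorm_le⟩ : ∃ K : ℝ, ∀ x,
      SchwartzMap.seminorm ℂ k m (reflTrans x ψ) ≤ (1 + ‖x‖) ^ k * K :=
    ⟨_, seminorm_reflTrans ψ k m _ fun z =>
      SchwartzMap.one_add_le_sup_seminorm_apply (𝕜 := ℂ) (m := (k, m)) le_rfl le_rfl ψ z⟩
  refine ((integrable_one_add_norm_pow_mul volume g k).mul_const K).mono'
    (g.continuous.smul
      ((weightedDeriv ℂ k m).continuous.comp (continuous_reflTrans ψ))).aestronglyMeasurable
    (ae_of_all _ fun x => ?_)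
  rw [norm_smul, norm_weightedDeriv, mul_comm ((1 + ‖x‖) ^ k), mul_assoc]
  exact mul_le_mul_of_nonneg_left (seminorm_le x) (norm_nonneg _)

theorem integral_mul_iteratedLineDerivOp_reflTrans {l : ℕ} (g ψ : 𝓢(Rn n, ℂ)) (v : Fin l → Rn n)
    (y : Rn n) : ∫ x, g x * (∂^{v} (reflTrans x ψ) : 𝓢(Rn n, ℂ)) y =
      (∂^{v} (conv g (reflTrans 0 ψ)) : 𝓢(Rn n, ℂ)) y := by
  simp [iteratedLineDerivOp_conv, conv_apply, iteratedLineDerivOp_reflTrans, reflTrans_apply]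

theorem integral_smul_weightedDeriv_reflTrans (g ψ : 𝓢(Rn n, ℂ)) (k m : ℕ) :
    ∫ x, g x • weightedDeriv ℂ k m (reflTrans x ψ) =
      weightedDeriv ℂ k m (conv g (reflTrans 0 ψ)) := by
  ext y v
  let eval : BoundedMultilinearField (Rn n) ℂ m →L[ℝ] ℂ :=
    (ContinuousMultilinearMap.apply ℝ (fun _ => Rn n) ℂ v) ∘L
      (BoundedContinuousFunction.evalCLM ℝ y)
  refine (eval.integral_comp_comm
    (integrable_smul_weightedDeriv_reflTrans g ψ k m)).symm.trans ?_
  rw [weightedDeriv_apply, smul_apply,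
    ← SchwartzMap.iteratedLineDerivOp_eq_iteratedFDeriv,
    ← integral_mul_iteratedLineDerivOp_reflTrans, ← integral_smul]
  refine integral_congr_ae (ae_of_all _ fun x => ?_)
  change g x * (‖y‖ ^ k • iteratedFDeriv ℝ m (reflTrans x ψ) y v) = _
  rw [← SchwartzMap.iteratedLineDerivOp_eq_iteratedFDeriv, mul_smul_comm]

theorem integral_mul_apply_reflTrans (w : 𝓢'(Rn n, ℂ)) (g ψ : 𝓢(Rn n, ℂ)) :
    ∫ x, g x * w (reflTrans x ψ) = w (conv g (reflTrans 0 ψ)) := by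
  obtain ⟨s, L, hw⟩ := exists_eq_sum_weightedDeriv w
  have term_eq (p : s) (x : Rn n) : g x * L p (weightedDeriv ℂ p.1.1 p.1.2 (reflTrans x ψ)) =
      L p (g x • weightedDeriv ℂ p.1.1 p.1.2 (reflTrans x ψ)) := by
    rw [map_smul, smul_eq_mul]
  simp_rw [hw, Finset.mul_sum, term_eq]
  rw [integral_finsetSum _ fun p _ =>
    (L p).integrable_comp (integrable_smul_weightedDeriv_reflTrans g ψ _ _)]
  refine Finset.sum_congr rfl fun p _ => ?_
  rw [(L p).integral_comp_comm (integrable_smul_weightedDeriv_reflTrans g ψ _ _),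
    integral_smul_weightedDeriv_reflTrans]

end TemperedDistribution

/-! ### Regularizations of a tempered distribution -/

section Regularization

variable {n : ℕ}

theorem monomial_neg (α : Fin n → ℕ) (x : Rn n) :
    monomial α (-x) = (-1) ^ (∑ i, α i) * monomial α x := by
  simp only [monomial, PiLp.neg_apply]
  rw [← Finset.prod_pow_eq_pow_sum, ← Finset.prod_mul_distrib]
  exact Finset.prod_congr rfl fun i _ => neg_pow (x i) (α i)

theorem IsMollifier.reflTrans_zero {φ : 𝓢(Rn n, ℂ)} (hφ : IsMollifier φ) :
    IsMollifier (reflTrans 0 φ) where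
  integral_eq_one := by
    simp_rw [reflTrans_apply, zero_sub]
    rw [integral_neg_eq_self (fun x => φ x), hφ.integral_eq_one]
  moment_eq_zero α hα := by
    simp_rw [reflTrans_apply, zero_sub]
    rw [← integral_neg_eq_self]
    simp_rw [neg_neg, monomial_neg, Complex.ofReal_mul, mul_assoc]
    rw [integral_const_mul, hφ.moment_eq_zero α hα, mul_zero]

theorem reflTrans_zero_dilate (φ : 𝓢(Rn n, ℂ)) (ε : Set.Ioc (0 : ℝ) 1) :
    reflTrans 0 (dilate φ ε) = dilate (reflTrans 0 φ) ε := by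
  ext x
  simp [reflTrans_apply, dilate_apply]

theorem IsMollifier.exists_norm_integral_mul_convNet_sub_le {φ : 𝓢(Rn n, ℂ)}
    (hφ : IsMollifier φ) (w : 𝓢'(Rn n, ℂ)) (g : 𝓢(Rn n, ℂ)) :
    ∃ C : ℝ, ∀ ε : Set.Ioc (0 : ℝ) 1, ‖(∫ x, g x * convNet φ w ε x) - w g‖ ≤ C * ε := by
  obtain ⟨s, C, hC, norm_le⟩ := exists_seminorm_bound w
  choose K _ seminorm_le using fun p : ℕ × ℕ =>
    hφ.reflTrans_zero.exists_seminorm_conv_dilate_sub_le p.1 p.2 0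
  refine ⟨C * ∑ p ∈ s, K p *
    ((Finset.Iic (p.1, 0 + 1 + p.2)).sup (schwartzSeminormFamily ℂ (Rn n) ℂ)) g, fun ε => ?_⟩
  have integral_eq : ∫ x, g x * convNet φ w ε x = w (conv (dilate (reflTrans 0 φ) ε) g) := by
    rw [← reflTrans_zero_dilate, ← conv_comm]
    exact integral_mul_apply_reflTrans w g (dilate φ ε)
  rw [integral_eq, ← map_sub, mul_assoc, Finset.sum_mul]
  refine (norm_le _).trans ?_
  gcongr with p
  refine (seminorm_le p g ε).trans_eq ?_
  rw [zero_add, pow_one]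
  ring

theorem conv_reflTrans (f g : 𝓢(Rn n, ℂ)) (x : Rn n) :
    conv (reflTrans x f) (reflTrans 0 g) = reflTrans x (conv g f) := by
  ext y
  rw [reflTrans_apply, conv_apply, conv_apply,
    ← integral_add_right_eq_self (fun t => reflTrans x f t * reflTrans 0 g (y - t)) y]
  refine integral_congr_ae (ae_of_all _ fun t => ?_)
  simp only [reflTrans_apply]
  rw [mul_comm]
  congr 2 <;> abel

theorem conv_apply_of_eq_apply_reflTrans {w : 𝓢'(Rn n, ℂ)} {f F : 𝓢(Rn n, ℂ)}
    (hF : ∀ x, F x = w (reflTrans x f)) (g : 𝓢(Rn n, ℂ)) (x : Rn n) :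
    conv g F x = w (reflTrans x (conv f g)) := by
  rw [conv_comm, conv_apply, ← conv_reflTrans, ← integral_mul_apply_reflTrans]
  refine integral_congr_ae (ae_of_all _ fun t => ?_)
  beta_reduce
  rw [hF, reflTrans_apply, mul_comm]

theorem conv_eq_conv_of_eq_apply_reflTrans {w : 𝓢'(Rn n, ℂ)} {f g F G : 𝓢(Rn n, ℂ)}
    (hF : ∀ x, F x = w (reflTrans x f)) (hG : ∀ x, G x = w (reflTrans x g)) :
    conv g F = conv f G := by
  ext x
  rw [conv_apply_of_eq_apply_reflTrans hF, conv_apply_of_eq_apply_reflTrans hG, conv_comm]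

/-- The scale `2⁻ʲ`, as an index of the nets; limits as `ε → 0` are taken along it. -/
noncomputable def dyadic (j : ℕ) : Set.Ioc (0 : ℝ) 1 :=
  ⟨(1 / 2) ^ j, by positivity, pow_le_one₀ (by norm_num) (by norm_num)⟩

theorem coe_dyadic (j : ℕ) : (dyadic j : ℝ) = (1 / 2) ^ j := rfl

theorem tendsto_dyadic : Tendsto (fun j => (dyadic j : ℝ)) atTop (𝓝 0) :=
  tendsto_pow_atTop_nhds_zero_of_lt_one (by norm_num) (by norm_num)

theorem IsMollifier.tendsto_integral_mul_convNet {φ : 𝓢(Rn n, ℂ)} (hφ : IsMollifier φ)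
    (w : 𝓢'(Rn n, ℂ)) (g : 𝓢(Rn n, ℂ)) :
    Tendsto (fun j => ∫ x, g x * convNet φ w (dyadic j) x) atTop (𝓝 (w g)) := by
  obtain ⟨C, hC⟩ := hφ.exists_norm_integral_mul_convNet_sub_le w g
  rw [tendsto_iff_norm_sub_tendsto_zero]
  refine squeeze_zero (fun _ => norm_nonneg _) (fun j => hC (dyadic j)) ?_
  simpa using tendsto_dyadic.const_mul C

end Regularization

/-! ### Nets of Schwartz functions -/

section MonomialBounds

variable {n : ℕ}

theorem norm_monomial_mul_listDeriv_le (f : 𝓢(Rn n, ℂ)) (α : Fin n → ℕ) (l : List (Fin n))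
    (x : Rn n) : ‖(monomial α x : ℂ) * listDeriv l f x‖ ≤
      SchwartzMap.seminorm ℂ (∑ i, α i) l.length f := by
  have norm_listDeriv_le : ‖listDeriv l f x‖ ≤ ‖iteratedFDeriv ℝ l.length f x‖ := by
    have := norm_iteratedFDeriv_listDerivS l f 0 x
    rwa [norm_iteratedFDeriv_zero, zero_add, ← listDeriv_schwartz] at this
  rw [norm_mul]
  exact (mul_le_mul (norm_monomial_le α x) norm_listDeriv_le (norm_nonneg _)
    (by positivity)).trans (SchwartzMap.le_seminorm ℂ _ _ f x)

theorem isNegligible_of_seminorm_le {F : Set.Ioc (0 : ℝ) 1 → 𝓢(Rn n, ℂ)}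
    (h : ∀ k m q : ℕ, ∃ C : ℝ, ∀ ε : Set.Ioc (0 : ℝ) 1,
      SchwartzMap.seminorm ℂ k m (F ε) ≤ C * (ε : ℝ) ^ q) :
    Net.IsNegligible (fun ε => ⇑(F ε) : Net n) := by
  refine (isNegligible_iff _).2 ⟨fun ε => (F ε).smooth ⊤, fun l α q => ?_⟩
  obtain ⟨C, hC⟩ := h (∑ i, α i) l.length q
  refine ⟨C, fun ε x => ?_⟩
  rw [inv_mul_le_iff₀ (pow_pos ε.2.1 q), mul_comm _ C]
  exact (norm_monomial_mul_listDeriv_le _ _ _ _).trans (hC ε)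

theorem isRegular_const (f : 𝓢(Rn n, ℂ)) : Net.IsRegular (fun _ => ⇑f : Net n) := by
  refine ⟨fun _ => f.smooth ⊤, 0, fun α β => ?_⟩
  simp_rw [pow_zero, one_mul, multiDeriv_eq_listDeriv]
  exact ⟨_, fun _ x => norm_monomial_mul_listDeriv_le f α _ x⟩

theorem iteratedFDeriv_apply_single {m : ℕ} {f : Rn n → ℂ} (hf : ContDiff ℝ ∞ f)
    (s : Fin m → Fin n) (x : Rn n) :
    iteratedFDeriv ℝ m f x (fun i => EuclideanSpace.single (s i) 1) =
      listDeriv (List.ofFn s) f x := by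
  induction m generalizing x with
  | zero => simp [listDeriv]
  | succ m ih =>
    have differentiableAt : DifferentiableAt ℝ (iteratedFDeriv ℝ m f) x :=
      hf.differentiable_iteratedFDeriv (mod_cast ENat.natCast_lt_top m) x
    calc _ = fderiv ℝ (iteratedFDeriv ℝ m f) x (EuclideanSpace.single (s 0) 1)
          fun i => EuclideanSpace.single (s i.succ) 1 := iteratedFDeriv_succ_apply_left _
      _ = fderiv ℝ (listDeriv (List.ofFn fun i => s i.succ) f) x
          (EuclideanSpace.single (s 0) 1) := by
        rw [← funext (ih fun i => s i.succ),
          fderiv_continuousMultilinear_apply_const_apply differentiableAt]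
      _ = listDeriv (List.ofFn s) f x := by
        rw [List.ofFn_succ]
        exact (congrFun (partialDeriv_eq (s 0) (contDiff_listDeriv _ hf)) x).symm

theorem opNorm_le_sum_norm_apply_single {ι F : Type*} [Fintype ι] [DecidableEq ι]
    [NormedAddCommGroup F] [NormedSpace ℝ F] {m : ℕ}
    (M : ContinuousMultilinearMap ℝ (fun _ : Fin m => EuclideanSpace ℝ ι) F) :
    ‖M‖ ≤ ∑ s : Fin m → ι, ‖M fun i => EuclideanSpace.single (s i) 1‖ := by
  refine ContinuousMultilinearMap.opNorm_le_bound (by positivity) fun v => ?_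
  have v_eq : v = fun i => ∑ j, v i j • EuclideanSpace.single j (1 : ℝ) := by
    ext1 i
    simpa using ((EuclideanSpace.basisFun ι ℝ).sum_repr (v i)).symm
  conv_lhs => rw [v_eq]
  rw [ContinuousMultilinearMap.map_sum, Finset.sum_mul]
  refine norm_sum_le_of_le _ fun s _ => ?_
  rw [ContinuousMultilinearMap.map_smul_univ, norm_smul, norm_prod, mul_comm]
  gcongr with i
  exact PiLp.norm_apply_le (v i) (s i)

theorem norm_pow_le_sum_norm_monomial (k : ℕ) (x : Rn n) :
    ‖x‖ ^ k ≤ ∑ s : Fin k → Fin n, ‖(monomial (indexCount s) x : ℂ)‖ := by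
  have norm_le : ‖x‖ ≤ ∑ j, ‖x j‖ := by
    conv_lhs => rw [← (EuclideanSpace.basisFun (Fin n) ℝ).sum_repr x]
    exact norm_sum_le_of_le _ fun j _ => by simp [norm_smul]
  calc ‖x‖ ^ k ≤ (∑ j, ‖x j‖) ^ k := by gcongr
    _ = ∑ s : Fin k → Fin n, ∏ i, ‖x (s i)‖ := by
        rw [← Fin.prod_const, Finset.prod_univ_sum, Fintype.piFinset_univ]
    _ = _ := by simp_rw [Complex.norm_real, monomial_indexCount, norm_prod]

theorem norm_pow_mul_iteratedFDeriv_le_sum {f : Rn n → ℂ} (hf : ContDiff ℝ ∞ f) (k m : ℕ)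
    (x : Rn n) : ‖x‖ ^ k * ‖iteratedFDeriv ℝ m f x‖ ≤
      ∑ s : Fin k → Fin n, ∑ r : Fin m → Fin n,
        ‖(monomial (indexCount s) x : ℂ) * listDeriv (List.ofFn r) f x‖ := by
  simp_rw [norm_mul, ← iteratedFDeriv_apply_single hf]
  rw [← Finset.sum_mul_sum]
  gcongr
  · exact norm_pow_le_sum_norm_monomial k x
  · exact opNorm_le_sum_norm_apply_single _

theorem Net.IsRegular.exists_pow_mul_norm_iteratedFDeriv_le {u : Net n} (hu : u.IsRegular) :
    ∃ N : ℕ, ∀ k m : ℕ, ∃ C : ℝ, ∀ (ε : Set.Ioc (0 : ℝ) 1) (x : Rn n),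
      (ε : ℝ) ^ N * (‖x‖ ^ k * ‖iteratedFDeriv ℝ m (u ε) x‖) ≤ C := by
  obtain ⟨smooth, N, bound⟩ := hu
  choose C hC using (forall_multiDeriv_iff smooth fun v : Net n => ∀ α : Fin n → ℕ, ∃ C : ℝ,
    ∀ (ε : Set.Ioc (0 : ℝ) 1) (x : Rn n), (ε : ℝ) ^ N * ‖monomial α x * v ε x‖ ≤ C).1
      fun β α => bound α β
  refine ⟨N, fun k m => ⟨∑ s : Fin k → Fin n, ∑ r : Fin m → Fin n,
    C (List.ofFn r) (indexCount s), fun ε x => ?_⟩⟩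
  refine (mul_le_mul_of_nonneg_left (norm_pow_mul_iteratedFDeriv_le_sum (smooth ε) k m x)
    (pow_nonneg ε.2.1.le N)).trans ?_
  simp_rw [Finset.mul_sum]
  exact Finset.sum_le_sum fun s _ => Finset.sum_le_sum fun r _ => hC _ _ ε x

/-- Every Schwartz seminorm of `F ε` grows at most like `ε⁻ᴺ`, with the same `N` for all
seminorms: the Schwartz form of the regularity of a net. -/
def IsSchwartzModerate (N : ℕ) (F : Set.Ioc (0 : ℝ) 1 → 𝓢(Rn n, ℂ)) : Prop :=
  ∀ k m : ℕ, ∃ C : ℝ, ∀ ε : Set.Ioc (0 : ℝ) 1, (ε : ℝ) ^ N * SchwartzMap.seminorm ℂ k m (F ε) ≤ C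

theorem Net.IsRegular.exists_isSchwartzModerate {u : Net n} (hu : u.IsRegular) :
    ∃ (F : Set.Ioc (0 : ℝ) 1 → 𝓢(Rn n, ℂ)) (N : ℕ), (∀ ε, ⇑(F ε) = u ε) ∧
      IsSchwartzModerate N F := by
  obtain ⟨N, bound⟩ := hu.exists_pow_mul_norm_iteratedFDeriv_le
  choose C hC using bound
  have decay (k m : ℕ) (ε : Set.Ioc (0 : ℝ) 1) (x : Rn n) :
      ‖x‖ ^ k * ‖iteratedFDeriv ℝ m (u ε) x‖ ≤ ((ε : ℝ) ^ N)⁻¹ * C k m :=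
    (le_inv_mul_iff₀ (pow_pos ε.2.1 N)).2 (hC k m ε x)
  refine ⟨fun ε => ⟨u ε, hu.1 ε, fun k m => ⟨_, decay k m ε⟩⟩, N, fun _ => rfl,
    fun k m => ⟨C k m, fun ε => ?_⟩⟩
  rw [← le_inv_mul_iff₀ (pow_pos ε.2.1 N)]
  refine SchwartzMap.seminorm_le_bound ℂ k m _ ?_ (decay k m ε)
  exact le_trans (by positivity) (decay k m ε 0)

theorem IsSchwartzModerate.exists_sup_seminorm_le {N : ℕ} {F : Set.Ioc (0 : ℝ) 1 → 𝓢(Rn n, ℂ)}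
    (hF : IsSchwartzModerate N F) (s : Finset (ℕ × ℕ)) :
    ∃ C : ℝ, ∀ ε : Set.Ioc (0 : ℝ) 1,
      (ε : ℝ) ^ N * (s.sup (schwartzSeminormFamily ℂ (Rn n) ℂ)) (F ε) ≤ C := by
  choose C hC using hF
  refine ⟨∑ p ∈ s, C p.1 p.2, fun ε => ?_⟩
  calc (ε : ℝ) ^ N * (s.sup (schwartzSeminormFamily ℂ (Rn n) ℂ)) (F ε)
      ≤ (ε : ℝ) ^ N * ∑ p ∈ s, SchwartzMap.seminorm ℂ p.1 p.2 (F ε) := by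
        refine mul_le_mul_of_nonneg_left ?_ (pow_nonneg ε.2.1.le N)
        refine Seminorm.finset_sup_apply_le
          (Finset.sum_nonneg fun _ _ => apply_nonneg _ _) fun p hp => ?_
        exact Finset.single_le_sum (f := fun p : ℕ × ℕ => SchwartzMap.seminorm ℂ p.1 p.2 (F ε))
          (fun _ _ => apply_nonneg _ _) hp
    _ ≤ _ := by
        rw [Finset.mul_sum]
        exact Finset.sum_le_sum fun p _ => hC p.1 p.2 ε

end MonomialBounds

/-! ### Summable families of Schwartz functions -/

section Summable

variable {𝕜 E F ι : Type*} [RCLike 𝕜] [NormedAddCommGroup E] [NormedSpace ℝ E]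
  [NormedAddCommGroup F] [NormedSpace ℝ F] [NormedSpace 𝕜 F] [SMulCommClass ℝ 𝕜 F]
  [CompleteSpace F]

theorem exists_eq_tsum_of_summable_seminorm {f : ι → 𝓢(E, F)}
    (hf : ∀ k m, Summable fun i => SchwartzMap.seminorm 𝕜 k m (f i)) :
    ∃ g : 𝓢(E, F), (∀ x, g x = ∑' i, f i x) ∧
      ∀ k m, SchwartzMap.seminorm 𝕜 k m g ≤ ∑' i, SchwartzMap.seminorm 𝕜 k m (f i) := by
  have norm_le (m : ℕ) (i : ι) (x : E) :
      ‖iteratedFDeriv ℝ m (f i) x‖ ≤ SchwartzMap.seminorm 𝕜 0 m (f i) := by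
    simpa only [pow_zero, one_mul] using SchwartzMap.le_seminorm 𝕜 0 m (f i) x
  have smooth : ContDiff ℝ ∞ fun x => ∑' i, f i x :=
    contDiff_tsum (fun i => (f i).smooth ⊤) (fun m _ => hf 0 m) fun m i x _ => norm_le m i x
  have decay (k m : ℕ) (x : E) : ‖x‖ ^ k * ‖iteratedFDeriv ℝ m (fun x => ∑' i, f i x) x‖ ≤
      ∑' i, SchwartzMap.seminorm 𝕜 k m (f i) := by
    have summable_norm : Summable fun i => ‖iteratedFDeriv ℝ m (f i) x‖ :=
      Summable.of_nonneg_of_le (fun _ => norm_nonneg _) (fun i => norm_le m i x) (hf 0 m)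
    rw [iteratedFDeriv_tsum_apply (N := ⊤) (fun i => (f i).smooth ⊤) (fun m _ => hf 0 m)
      (fun m i x _ => norm_le m i x) (mod_cast le_top)]
    calc _ ≤ ‖x‖ ^ k * ∑' i, ‖iteratedFDeriv ℝ m (f i) x‖ := by
          gcongr
          exact norm_tsum_le_tsum_norm summable_norm
      _ = ∑' i, ‖x‖ ^ k * ‖iteratedFDeriv ℝ m (f i) x‖ := tsum_mul_left.symm
      _ ≤ _ := (summable_norm.mul_left _).tsum_le_tsum
          (fun i => SchwartzMap.le_seminorm 𝕜 k m (f i) x) (hf k m)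
  exact ⟨⟨fun x => ∑' i, f i x, smooth, fun k m => ⟨_, decay k m⟩⟩, fun _ => rfl, fun k m =>
    SchwartzMap.seminorm_le_bound 𝕜 k m _ (tsum_nonneg fun _ => apply_nonneg _ _) (decay k m)⟩

theorem summable_of_summable_seminorm {f : ι → 𝓢(E, F)}
    (hf : ∀ k m, Summable fun i => SchwartzMap.seminorm 𝕜 k m (f i)) : Summable f := by
  obtain ⟨g, g_apply, -⟩ := exists_eq_tsum_of_summable_seminorm hf
  have summable_apply (x : E) : Summable fun i => f i x :=
    Summable.of_norm_bounded (hf 0 0) fun i => SchwartzMap.norm_le_seminorm 𝕜 (f i) x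
  have seminorm_sub_le (k m : ℕ) (s : Finset ι) :
      SchwartzMap.seminorm 𝕜 k m (∑ i ∈ s, f i - g) ≤
        ∑' i : {i // i ∉ s}, SchwartzMap.seminorm 𝕜 k m (f i) := by
    obtain ⟨r, r_apply, seminorm_r_le⟩ := exists_eq_tsum_of_summable_seminorm (𝕜 := 𝕜)
      (f := fun i : {i // i ∉ s} => f i) fun k m => (hf k m).subtype _
    have g_eq : g = ∑ i ∈ s, f i + r := by
      ext x
      rw [g_apply, ← (summable_apply x).sum_add_tsum_subtype_compl s, add_apply, r_apply,
        sum_apply]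
    rw [g_eq, sub_add_cancel_left, map_neg_eq_map]
    exact seminorm_r_le k m
  refine ⟨g, ((schwartz_withSeminorms 𝕜 E F).tendsto_nhds _ _).2 fun p ε hε => ?_⟩
  filter_upwards [(tendsto_tsum_compl_atTop_zero fun i =>
    SchwartzMap.seminorm 𝕜 p.1 p.2 (f i)).eventually_lt_const hε] with s hs
  exact (seminorm_sub_le p.1 p.2 s).trans_lt hs

theorem exists_tendsto_of_summable_seminorm_sub {f : ℕ → 𝓢(E, F)}
    (hf : ∀ k m, Summable fun j => SchwartzMap.seminorm 𝕜 k m (f (j + 1) - f j)) :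
    ∃ g : 𝓢(E, F), Tendsto f atTop (𝓝 g) := by
  obtain ⟨d, hd⟩ := summable_of_summable_seminorm hf
  refine ⟨f 0 + d, (hd.tendsto_sum_nat.const_add (f 0)).congr fun j => ?_⟩
  rw [Finset.sum_range_sub, add_sub_cancel]

end Summable

/-! ### The embedding of tempered distributions -/

section Embedding

variable {n : ℕ}

theorem mk_eq_mk_iff_isNegligible_sub (u v : moderate n) :
    Ideal.Quotient.mk (negligible n) u = Ideal.Quotient.mk (negligible n) v ↔
      Net.IsNegligible ((u : Net n) - (v : Net n)) := by
  rw [Ideal.Quotient.eq]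
  rfl

theorem Net.IsNegligible.exists_norm_le {u : Net n} (hu : u.IsNegligible) (q : ℕ) :
    ∃ C : ℝ, ∀ (ε : Set.Ioc (0 : ℝ) 1) (x : Rn n), ‖u ε x‖ ≤ C * (ε : ℝ) ^ q := by
  obtain ⟨C, hC⟩ := ((isNegligible_iff u).1 hu).2 [] 0 q
  refine ⟨C, fun ε x => ?_⟩
  have := hC ε x
  rw [inv_mul_le_iff₀ (pow_pos ε.2.1 q), mul_comm _ C] at this
  simpa [monomial, netDeriv, listDeriv] using this

theorem Net.IsNegligible.tendsto_integral_mul {u : Net n} (hu : u.IsNegligible)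
    (g : 𝓢(Rn n, ℂ)) : Tendsto (fun j => ∫ x, g x * u (dyadic j) x) atTop (𝓝 0) := by
  obtain ⟨C, hC⟩ := hu.exists_norm_le 1
  have norm_integral_le (j : ℕ) :
      ‖∫ x, g x * u (dyadic j) x‖ ≤ (∫ x, ‖g x‖) * (C * dyadic j ^ 1) := by
    rw [← integral_mul_const]
    refine norm_integral_le_of_norm_le (g.integrable.norm.mul_const _) (ae_of_all _ fun x => ?_)
    rw [norm_mul]
    exact mul_le_mul_of_nonneg_left (hC _ x) (norm_nonneg _)
  refine squeeze_zero_norm norm_integral_le ?_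
  simpa using (tendsto_dyadic.const_mul C).const_mul (∫ x, ‖g x‖)

theorem IsMollifier.embedTempered_injective {φ : 𝓢(Rn n, ℂ)} (hφ : IsMollifier φ) :
    Function.Injective (embedTempered φ) := by
  rw [injective_iff_map_eq_zero]
  intro w hw
  have isNegligible : Net.IsNegligible (convNet φ w) := by
    simpa using (mk_eq_mk_iff_isNegligible_sub ⟨convNet φ w, convNet_isModerate φ w⟩ 0).1
      (hw.trans (map_zero _).symm)
  ext g
  exact tendsto_nhds_unique (hφ.tendsto_integral_mul_convNet w g)
    (isNegligible.tendsto_integral_mul g)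

theorem IsMollifier.isNegligible_conv_dilate_sub {φ : 𝓢(Rn n, ℂ)} (hφ : IsMollifier φ)
    (f : 𝓢(Rn n, ℂ)) : Net.IsNegligible (fun ε => ⇑(conv (dilate φ ε) f - f) : Net n) := by
  refine isNegligible_of_seminorm_le fun k m q => ?_
  obtain ⟨C, hC, seminorm_le⟩ := hφ.exists_seminorm_conv_dilate_sub_le k m q
  set p := (Finset.Iic (k, q + 1 + m)).sup (schwartzSeminormFamily ℂ (Rn n) ℂ)
  refine ⟨C * p f, fun ε => (seminorm_le f ε).trans ?_⟩
  rw [mul_right_comm]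
  exact mul_le_mul_of_nonneg_left (pow_le_pow_of_le_one ε.2.1.le ε.2.2 q.le_succ)
    (mul_nonneg hC (apply_nonneg _ _))

theorem IsMollifier.embedTempered_toTempered {φ : 𝓢(Rn n, ℂ)} (hφ : IsMollifier φ)
    (f : 𝓢(Rn n, ℂ)) :
    embedTempered φ (SchwartzMap.toTemperedDistributionCLM (Rn n) ℂ volume f) =
      embedSchwartz n f := by
  refine (mk_eq_mk_iff_isNegligible_sub ⟨_, convNet_isModerate φ _⟩
    ⟨_, constNet_isModerate f⟩).2 ?_
  convert hφ.isNegligible_conv_dilate_sub f using 1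
  ext ε x
  change SchwartzMap.toTemperedDistributionCLM (Rn n) ℂ volume f (reflTrans x (dilate φ ε)) - f x =
    conv (dilate φ ε) f x - f x
  rw [toTemperedDistributionCLM_reflTrans, conv_comm]

end Embedding

/-! ### Regular tempered distributions -/

section Regular

variable {n : ℕ}

theorem Net.IsRegular.add_isNegligible {u v : Net n} (hu : u.IsRegular) (hv : v.IsNegligible) :
    (u + v).IsRegular := by
  obtain ⟨smooth_u, N, bound_u⟩ := hu
  refine ⟨fun ε => (smooth_u ε).add (hv.1 ε), N, fun α β => ?_⟩
  obtain ⟨C, hC⟩ := bound_u α β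
  obtain ⟨D, hD⟩ := hv.2 α β 0
  simp_rw [pow_zero, inv_one, one_mul] at hD
  refine ⟨C + D, fun ε x => ?_⟩
  have multiDeriv_add :
      multiDeriv β ((u + v) ε) x = multiDeriv β (u ε) x + multiDeriv β (v ε) x := by
    simp only [multiDeriv_eq_listDeriv]
    exact congrFun (listDeriv_add _ (smooth_u ε) (hv.1 ε)) x
  rw [multiDeriv_add, mul_add]
  calc _ ≤ (ε : ℝ) ^ N * (‖monomial α x * multiDeriv β (u ε) x‖ +
        ‖monomial α x * multiDeriv β (v ε) x‖) :=
        mul_le_mul_of_nonneg_left (norm_add_le _ _) (pow_nonneg ε.2.1.le N)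
    _ = (ε : ℝ) ^ N * ‖monomial α x * multiDeriv β (u ε) x‖ +
        (ε : ℝ) ^ N * ‖monomial α x * multiDeriv β (v ε) x‖ := mul_add _ _ _
    _ ≤ C + D := add_le_add (hC ε x) ((mul_le_of_le_one_left (norm_nonneg _)
        (pow_le_one₀ ε.2.1.le ε.2.2)).trans (hD ε x))

theorem IsMollifier.exists_seminorm_sub_le {N : ℕ} {φ : 𝓢(Rn n, ℂ)} (hφ : IsMollifier φ)
    {F : Set.Ioc (0 : ℝ) 1 → 𝓢(Rn n, ℂ)} (hF : IsSchwartzModerate N F)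
    (conv_eq : ∀ ε δ, conv (dilate φ δ) (F ε) = conv (dilate φ ε) (F δ)) (k m : ℕ) :
    ∃ C : ℝ, ∀ ε δ : Set.Ioc (0 : ℝ) 1, (ε : ℝ) ≤ δ → (δ : ℝ) ≤ 2 * ε →
      SchwartzMap.seminorm ℂ k m (F ε - F δ) ≤ C * δ := by
  obtain ⟨C, hC, seminorm_le⟩ := hφ.exists_seminorm_conv_dilate_sub_le k m N
  obtain ⟨D, hD⟩ := hF.exists_sup_seminorm_le (Finset.Iic (k, N + 1 + m))
  refine ⟨C * (1 + 2 ^ N) * D, fun ε δ hεδ hδε => ?_⟩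
  set p := (Finset.Iic (k, N + 1 + m)).sup (schwartzSeminormFamily ℂ (Rn n) ℂ)
  have hε : (0 : ℝ) < ε := ε.2.1
  have hδ : (0 : ℝ) < δ := δ.2.1
  have sub_eq : F ε - F δ =
      (conv (dilate φ ε) (F δ) - F δ) - (conv (dilate φ δ) (F ε) - F ε) := by
    rw [conv_eq ε δ]
    abel
  calc SchwartzMap.seminorm ℂ k m (F ε - F δ)
      ≤ C * (ε : ℝ) ^ (N + 1) * p (F δ) + C * (δ : ℝ) ^ (N + 1) * p (F ε) := by
        rw [sub_eq]
        exact (map_sub_le_add _ _ _).trans (add_le_add (seminorm_le _ _) (seminorm_le _ _))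
    _ ≤ C * ((δ : ℝ) ^ N * δ) * p (F δ) + C * ((2 * ε) ^ N * δ) * p (F ε) := by
        rw [pow_succ, pow_succ]
        gcongr
    _ = C * ((δ : ℝ) ^ N * p (F δ)) * δ + C * (2 ^ N * ((ε : ℝ) ^ N * p (F ε))) * δ := by
        rw [mul_pow]
        ring
    _ ≤ C * D * δ + C * (2 ^ N * D) * δ := by
        gcongr
        · exact hD δ
        · exact hD ε
    _ = C * (1 + 2 ^ N) * D * δ := by ring

theorem IsMollifier.exists_tendsto_dyadic {N : ℕ} {φ : 𝓢(Rn n, ℂ)} (hφ : IsMollifier φ)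
    {F : Set.Ioc (0 : ℝ) 1 → 𝓢(Rn n, ℂ)} (hF : IsSchwartzModerate N F)
    (conv_eq : ∀ ε δ, conv (dilate φ δ) (F ε) = conv (dilate φ ε) (F δ)) :
    ∃ f : 𝓢(Rn n, ℂ), Tendsto (fun j => F (dyadic j)) atTop (𝓝 f) := by
  refine exists_tendsto_of_summable_seminorm_sub (𝕜 := ℂ) fun k m => ?_
  obtain ⟨C, hC⟩ := hφ.exists_seminorm_sub_le hF conv_eq k m
  refine Summable.of_nonneg_of_le (fun _ => apply_nonneg _ _) (fun j => hC _ _ ?_ ?_)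
    (summable_geometric_two.mul_left C)
  · exact pow_le_pow_of_le_one (by norm_num) (by norm_num) j.le_succ
  · rw [coe_dyadic, coe_dyadic, pow_succ]
    linarith

theorem IsMollifier.exists_toTempered_eq_of_isRegular {φ : 𝓢(Rn n, ℂ)} (hφ : IsMollifier φ)
    {w : 𝓢'(Rn n, ℂ)} (hw : (convNet φ w).IsRegular) :
    ∃ f : 𝓢(Rn n, ℂ), SchwartzMap.toTemperedDistributionCLM (Rn n) ℂ volume f = w := by
  obtain ⟨F, N, F_eq, hF⟩ := hw.exists_isSchwartzModerate
  have conv_eq (ε δ) : conv (dilate φ δ) (F ε) = conv (dilate φ ε) (F δ) :=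
    conv_eq_conv_of_eq_apply_reflTrans (congrFun (F_eq ε)) (congrFun (F_eq δ))
  obtain ⟨f, hf⟩ := hφ.exists_tendsto_dyadic hF conv_eq
  refine ⟨f, ?_⟩
  ext g
  have tendsto_apply :
      Tendsto (fun j => SchwartzMap.toTemperedDistributionCLM (Rn n) ℂ volume (F (dyadic j)) g)
        atTop (𝓝 (SchwartzMap.toTemperedDistributionCLM (Rn n) ℂ volume f g)) :=
    PointwiseConvergenceCLM.tendsto_iff_forall_tendsto.1
      (((SchwartzMap.toTemperedDistributionCLM (Rn n) ℂ volume).continuous.tendsto f).comp hf) g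
  refine tendsto_nhds_unique tendsto_apply ?_
  simp_rw [SchwartzMap.toTemperedDistributionCLM_apply_apply, F_eq, smul_eq_mul]
  exact hφ.tendsto_integral_mul_convNet w g

theorem IsMollifier.sRegular_inter_range {φ : 𝓢(Rn n, ℂ)} (hφ : IsMollifier φ) :
    sRegular n ∩ Set.range (embedTempered φ) = Set.range (embedSchwartz n) := by
  refine Set.Subset.antisymm ?_ ?_
  · rintro _ ⟨⟨u, mk_u, regular_u⟩, w, rfl⟩
    have isNegligible_sub : Net.IsNegligible (convNet φ w - (u : Net n)) :=
      (mk_eq_mk_iff_isNegligible_sub ⟨_, convNet_isModerate φ w⟩ u).1 mk_u.symm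
    have isRegular : (convNet φ w).IsRegular := by
      simpa only [add_sub_cancel] using regular_u.add_isNegligible isNegligible_sub
    obtain ⟨f, rfl⟩ := hφ.exists_toTempered_eq_of_isRegular isRegular
    exact ⟨f, (hφ.embedTempered_toTempered f).symm⟩
  · rintro _ ⟨f, rfl⟩
    exact ⟨⟨⟨_, constNet_isModerate f⟩, rfl, isRegular_const f⟩, _, hφ.embedTempered_toTempered f⟩

end Regular

end Colombeau

/-- `S'(ℝⁿ)` is embedded in `G_{τ,S}(ℝⁿ)` by `w ↦ [(w ∗ φ_ε)_ε]`; on `S(ℝⁿ)` this embedding is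
`f ↦ [(f)_ε]`; and, inside `G_{τ,S}(ℝⁿ)`, `G^∞_S(ℝⁿ) ∩ S'(ℝⁿ) = S(ℝⁿ)`. -/
theorem theorem2p1 (n : ℕ) (φ : 𝓢(Colombeau.Rn n, ℂ)) (hφ : Colombeau.IsMollifier φ) :
    Function.Injective (Colombeau.embedTempered φ) ∧
    (∀ f : 𝓢(Colombeau.Rn n, ℂ),
      Colombeau.embedTempered φ
          (SchwartzMap.toTemperedDistributionCLM (Colombeau.Rn n) ℂ MeasureTheory.volume f) =
        Colombeau.embedSchwartz n f) ∧
    Colombeau.sRegular n ∩ Set.range (Colombeau.embedTempered φ) =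
      Set.range (Colombeau.embedSchwartz n) :=
  ⟨hφ.embedTempered_injective, hφ.embedTempered_toTempered, hφ.sRegular_inter_range⟩
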